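/- Let $\Gamma$ be a discrete group, $\omega\colon\Gamma\times\Gamma\to U(1)$ a normalized $2$-cocycle, and $A$ a (not necessarily unital) $C^*$-algebra, faithfully and nondegenerately represented on a Hilbert space $H$. Minimal tensor products such as $C^*_r(\Gamma)\otimes A$ are realised on $\ell^2(\Gamma)\otimes H$; $M(\cdot)$ denotes the multiplier algebra and $\iota$ the identity map. Let $\lambda^{(\omega)}_g\delta_h=\omega(g,h)\delta_{gh}$ on $\ell^2(\Gamma)$, let $C^*_{r,\omega}(\Gamma)$ be the $C^*$-algebra generated by the $\lambda^{(\omega)}_g$, $C^*_r(\Gamma)$ the one for $\omega=1$, generated by the $\lambda_g$, with coproduct $\delta(\lambda_g)=\lambda_g\otimes\lambda_g$. A coaction of $C^*_r(\Gamma)$ on $A$ is a $*$-homomorphism $\alpha\colon A\to C^*_r(\Gamma)\otimes A$ with $(\iota\otimes\alpha)\alpha=(\delta\otimes\iota)\alpha$ and such that the span of $(C^*_r(\Gamma)\otimes1)\alpha(A)$ is dense in $C^*_r(\Gamma)\otimes A$. Coactions $\alpha,\beta$ on $A$ are exterior equivalent if there is a unitary $X\in M(C^*_r(\Gamma)\otimes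 A)$ with $X_{23}\,(\iota\otimes\alpha)(X)=(\delta\otimes\iota)(X)$ (an $\alpha$-cocycle) and $X\alpha(a)X^*=\beta(a)$ for all $a\in A$. The braided tensor product $A\boxtimes_\alpha C^*_{r,\omega}(\Gamma)$ is the $C^*$-algebra of operators on $\ell^2(\Gamma)\otimes H\otimes\ell^2(\Gamma)$ generated by the $\alpha(a)_{12}\,\widetilde{\mathrm{Ad}}{}^{(\omega)}(x)_{13}$, $a\in A$, $x\in C^*_{r,\omega}(\Gamma)$, where $\widetilde{\mathrm{Ad}}{}^{(\omega)}(x)=\sum_h\delta_h\otimes\mathrm{Ad}_{\lambda^{(\omega)}_{h^{-1}}}(x)$. Its diagonal coaction $\Delta$ of $C^*_r(\Gamma)$ is determined by $$\Delta\bigl(\alpha(a)_{12}\,\widetilde{\mathrm{Ad}}{}^{(\omega)}(\lambda^{(\omega)}_g)_{13}\bigr)=(\delta\otimes\iota)(\alpha(a))_{123}\,\bigl(\lambda_g\otimes\widetilde{\mathrm{Ad}}{}^{(\omega)}(\lambda^{(\omega)}_g)\bigr)_{124};$$ it is the restriction of $T\mapsto Z(1\otimes T)Z^*$, where $Z$ is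 the unitary $\delta_r\otimes\delta_s\otimes\xi\otimes\delta_t\mapsto\delta_{str}\otimes\delta_s\otimes\xi\otimes\delta_t$. The deformed algebra $A_{\alpha,\omega}$ is the fixed point algebra $\{T\in A\boxtimes_\alpha C^*_{r,\overline\omega}(\Gamma):\Delta(T)=1\otimes T\}$. Proposition. Let $\alpha$ and $\beta$ be exterior equivalent coactions of $C^*_r(\Gamma)$ on $A$. Then $A_{\alpha,\omega}$ and $A_{\beta,\omega}$ are strongly Morita equivalent, that is, there is a complete $A_{\alpha,\omega}$-$A_{\beta,\omega}$ imprimitivity bimodule. More precisely, for every $\alpha$-cocycle $X$ with $X\alpha(a)X^*=\beta(a)$ for all $a\in A$, the space $$E_X=\{T\in (A\boxtimes_\alpha C^*_{r,\overline\omega}(\Gamma))\,X_{12}^*\;:\;Z(1\otimes T)Z^*=1\otimes T\}$$ with the operator norm, the left action of $A_{\alpha,\omega}$ and the right action of $A_{\beta,\omega}$ by multiplication of operators, and the inner products ${}_{A_{\alpha,\omega}}\langle S,T\rangle=ST^*$ and $\langle S,T\rangle_{A_{\beta,\omega}}=S^*T$, is such an imprimitivity bimodule. -/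

import Mathlib

set_option linter.unusedSectionVars false

noncomputable section

namespace Coact

/-! ### Hilbert spaces of the form `ℓ²(I) ⊗ H` -/

section Hilbert

universe u₁ u₂ u₃ v

/-- The Hilbert space `ℓ²(I) ⊗ H`, realised as the space of square summable families `I → H`;
`δ_i ⊗ ξ` is the family supported at `i` with value `ξ`. -/
abbrev L2 (I : Type u₁) (H : Type v) [NormedAddCommGroup H] : Type (max u₁ v) :=
  lp (fun _ : I => H) 2

variable {I : Type u₁} {J : Type u₂} {M : Type u₃}
variable {H : Type v} [NormedAddCommGroup H]

theorem memlp_two_iff {f : I → H} : Memℓp f 2 ↔ Summable fun i => ‖f i‖ ^ 2 := by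
  rw [memℓp_gen_iff (by norm_num)]
  simp

theorem L2.summable (f : L2 I H) : Summable fun i => ‖f i‖ ^ 2 :=
  memlp_two_iff.1 (lp.memℓp f)

theorem L2.norm_sq (f : L2 I H) : ‖f‖ ^ 2 = ∑' i, ‖f i‖ ^ 2 := by
  have h := lp.norm_rpow_eq_tsum (p := 2) (by norm_num) f
  simpa using h

/-- The vector of `ℓ²(I) ⊗ H` with the given components. -/
def L2.mk (f : I → H) (hf : Summable fun i => ‖f i‖ ^ 2) : L2 I H :=
  ⟨f, memlp_two_iff.2 hf⟩

@[simp] theorem L2.mk_apply (f : I → H) (hf : Summable fun i => ‖f i‖ ^ 2) (i : I) :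
    L2.mk f hf i = f i := rfl

variable [InnerProductSpace ℂ H]

theorem monomial_summable (e : I ≃ J) (c : I → Circle) (f : L2 I H) :
    Summable fun j => ‖(c (e.symm j) : ℂ) • f (e.symm j)‖ ^ 2 := by
  simp only [norm_smul, Circle.norm_coe, one_mul]
  exact (e.symm.summable_iff (f := fun i => ‖f i‖ ^ 2)).2 f.summable

/-- The unitary `δ_i ⊗ ξ ↦ c i • δ_{e i} ⊗ ξ` from `ℓ²(I) ⊗ H` onto `ℓ²(J) ⊗ H`. -/
def monomial (e : I ≃ J) (c : I → Circle) : L2 I H ≃ₗᵢ[ℂ] L2 J H where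
  toFun f := L2.mk (fun j => (c (e.symm j) : ℂ) • f (e.symm j)) (monomial_summable e c f)
  invFun f := L2.mk (fun i => ((c i)⁻¹ : ℂ) • f (e i)) (by
    simp only [norm_smul, norm_inv, Circle.norm_coe, inv_one, one_mul]
    exact (e.summable_iff (f := fun i => ‖f i‖ ^ 2)).2 f.summable)
  left_inv f := by ext i; simp
  right_inv f := by ext i; simp
  map_add' f g := by ext i; simp
  map_smul' a f := by ext i; exact smul_comm _ _ _
  norm_map' f := by
    rw [← sq_eq_sq₀ (norm_nonneg _) (norm_nonneg _), L2.norm_sq, L2.norm_sq]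
    simp only [LinearEquiv.coe_mk, LinearMap.coe_mk, AddHom.coe_mk, L2.mk_apply, norm_smul,
      Circle.norm_coe, one_mul]
    exact e.symm.tsum_eq (fun i => ‖f i‖ ^ 2)

@[simp] theorem monomial_apply (e : I ≃ J) (c : I → Circle) (f : L2 I H) (j : J) :
    monomial e c f j = (c (e.symm j) : ℂ) • f (e.symm j) := rfl

@[simp] theorem monomial_symm_apply (e : I ≃ J) (c : I → Circle) (f : L2 J H) (i : I) :
    (monomial e c).symm f i = ((c i)⁻¹ : ℂ) • f (e i) := rfl

/-- The identification `ℓ²(M × I) ⊗ H = ℓ²(M) ⊗ (ℓ²(I) ⊗ H)`. -/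
def curry : L2 (M × I) H ≃ₗᵢ[ℂ] L2 M (L2 I H) where
  toFun f := L2.mk
    (fun m => L2.mk (fun i => f (m, i))
      ((summable_prod_of_nonneg (fun _ => by positivity)).1 f.summable |>.1 m)) (by
      simp only [L2.norm_sq, L2.mk_apply]
      exact ((summable_prod_of_nonneg (fun _ => by positivity)).1 f.summable).2)
  invFun f := L2.mk (fun p => f p.1 p.2) (by
    refine (summable_prod_of_nonneg (fun _ => by positivity)).2 ⟨fun m => (f m).summable, ?_⟩
    simp only [← L2.norm_sq]
    exact f.summable)
  left_inv f := by ext p; simp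
  right_inv f := by ext m i; simp
  map_add' f g := by ext m i; simp
  map_smul' a f := by ext m i; simp
  norm_map' f := by
    rw [← sq_eq_sq₀ (norm_nonneg _) (norm_nonneg _), L2.norm_sq, L2.norm_sq]
    simp only [LinearEquiv.coe_mk, LinearMap.coe_mk, AddHom.coe_mk, L2.mk_apply, L2.norm_sq]
    exact (f.summable.tsum_prod).symm

@[simp] theorem curry_apply (f : L2 (M × I) H) (m : M) (i : I) : curry f m i = f (m, i) := rfl

@[simp] theorem curry_symm_apply (f : L2 M (L2 I H)) (p : M × I) :
    curry.symm f p = f p.1 p.2 := rfl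

variable {K : Type v} [NormedAddCommGroup K] [InnerProductSpace ℂ K]

theorem ampl_bound (T : H →L[ℂ] H) (f : L2 M H) (m : M) :
    ‖T (f m)‖ ^ 2 ≤ ‖T‖ ^ 2 * ‖f m‖ ^ 2 := by
  rw [← mul_pow]
  exact pow_le_pow_left₀ (norm_nonneg _) (T.le_opNorm _) 2

theorem ampl_summable (T : H →L[ℂ] H) (f : L2 M H) : Summable fun m => ‖T (f m)‖ ^ 2 :=
  Summable.of_nonneg_of_le (fun _ => by positivity) (ampl_bound T f)
    (f.summable.mul_left _)

/-- The operator `1 ⊗ T` on `ℓ²(M) ⊗ H`. -/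
def amplFun (T : H →L[ℂ] H) : L2 M H →L[ℂ] L2 M H :=
  LinearMap.mkContinuous
    { toFun := fun f => L2.mk (fun m => T (f m)) (ampl_summable T f)
      map_add' := fun f g => by ext m; simp
      map_smul' := fun a f => by ext m; simp } ‖T‖ (fun f => by
    rw [← sq_le_sq₀ (norm_nonneg _) (by positivity), mul_pow, L2.norm_sq, L2.norm_sq,
      ← tsum_mul_left]
    exact (ampl_summable T f).tsum_le_tsum (ampl_bound T f) (f.summable.mul_left _))

@[simp] theorem amplFun_apply (T : H →L[ℂ] H) (f : L2 M H) (m : M) :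
    amplFun T f m = T (f m) := rfl

variable [CompleteSpace H]

variable (M H) in
/-- The `*`-homomorphism `T ↦ 1 ⊗ T` from `B(H)` to `B(ℓ²(M) ⊗ H)`. -/
def amplHom : (H →L[ℂ] H) →⋆ₐ[ℂ] (L2 M H →L[ℂ] L2 M H) where
  toFun := amplFun
  map_one' := by ext; simp
  map_mul' S T := by ext; simp
  map_zero' := by ext; simp
  map_add' S T := by ext; simp
  commutes' a := by ext; simp [Algebra.algebraMap_eq_smul_one]
  map_star' T := by
    rw [ContinuousLinearMap.star_eq_adjoint, ContinuousLinearMap.star_eq_adjoint,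
      ContinuousLinearMap.eq_adjoint_iff]
    intro f g
    simp [lp.inner_eq_tsum, ContinuousLinearMap.adjoint_inner_left]

variable (M) in
/-- The operator `1 ⊗ T` on `ℓ²(M) ⊗ H`. -/
def ampl (T : H →L[ℂ] H) : L2 M H →L[ℂ] L2 M H := amplHom M H T

@[simp] theorem ampl_apply (T : H →L[ℂ] H) (f : L2 M H) (m : M) :
    ampl M T f m = T (f m) := rfl

/-- An operator on `ℓ²(M × I) ⊗ H` seen as an operator on `ℓ²(M) ⊗ (ℓ²(I) ⊗ H)`. -/
def unflatten (T : L2 (M × I) H →L[ℂ] L2 (M × I) H) : L2 M (L2 I H) →L[ℂ] L2 M (L2 I H) :=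
  curry.conjStarAlgEquiv T

variable (I M H) in
/-- The `*`-homomorphism `T ↦ 1 ⊗ T` from `B(ℓ²(I) ⊗ H)` to `B(ℓ²(M × I) ⊗ H)`. -/
def amplLHom : (L2 I H →L[ℂ] L2 I H) →⋆ₐ[ℂ] (L2 (M × I) H →L[ℂ] L2 (M × I) H) :=
  (curry (M := M) (I := I) (H := H)).symm.conjStarAlgEquiv.toStarAlgHom.comp (amplHom M _)

variable (M) in
/-- For `T` on `ℓ²(I) ⊗ H`, the operator `1 ⊗ T` on `ℓ²(M × I) ⊗ H`. -/
def amplL (T : L2 I H →L[ℂ] L2 I H) : L2 (M × I) H →L[ℂ] L2 (M × I) H := amplLHom I M H T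

theorem amplL_apply (T : L2 I H →L[ℂ] L2 I H) (f : L2 (M × I) H) (p : M × I) :
    amplL M T f p = T (curry f p.1) p.2 := rfl

theorem amplLHom_apply (T : L2 I H →L[ℂ] L2 I H) (f : L2 (M × I) H) (p : M × I) :
    amplLHom I M H T f p = T (curry f p.1) p.2 := rfl

variable (M) in
/-- For `T` on `ℓ²(I) ⊗ H`, the operator on `ℓ²(I × M) ⊗ H` that acts as `T` on the legs `ℓ²(I)`
and `H`, and trivially on the leg `ℓ²(M)`. -/
def amplR (T : L2 I H →L[ℂ] L2 I H) : L2 (I × M) H →L[ℂ] L2 (I × M) H :=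
  (monomial (H := H) (Equiv.prodComm M I) 1).conjStarAlgEquiv (amplL M T)

/-- The component of `f` in `ℓ²(I) ⊗ H` for a fixed second index. -/
def column (f : L2 (I × M) H) (m : M) : L2 I H :=
  curry ((monomial (Equiv.prodComm M I) 1).symm f) m

@[simp] theorem column_apply (f : L2 (I × M) H) (m : M) (i : I) : column f m i = f (i, m) := by
  simp [column]

theorem amplR_apply (T : L2 I H →L[ℂ] L2 I H) (f : L2 (I × M) H) (p : I × M) :
    amplR M T f p = T (column f p.2) p.1 := by
  simp [amplR, amplL_apply, column]

open Classical in
/-- The entry `s, t` of an operator on `ℓ²(M) ⊗ H`, that is, its slice by the functional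
`⟨δ_s, · δ_t⟩` on the first leg. -/
def entry (T : L2 M H →L[ℂ] L2 M H) (s t : M) : H →L[ℂ] H :=
  lp.evalCLM ℂ (fun _ : M => H) 2 s ∘L T ∘L lp.singleContinuousLinearMap ℂ (fun _ : M => H) 2 t

open Classical in
theorem entry_apply (T : L2 M H →L[ℂ] L2 M H) (s t : M) (v : H) :
    entry T s t v = T (lp.single 2 t v) s := rfl

/-- An operator is determined by its entries. -/
theorem ext_entry {S T : L2 M H →L[ℂ] L2 M H} (h : ∀ s t, entry S s t = entry T s t) : S = T := by
  classical
  ext f : 1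
  have hf := lp.hasSum_single (p := 2) (by norm_num) f
  refine (hf.mapL S).unique ?_
  convert hf.mapL T using 2 with t
  ext s
  have := congrArg (fun U : H →L[ℂ] H => U (f t)) (h s t)
  simp only [entry_apply] at this
  convert this

end Hilbert

/-! ### Strong Morita equivalence -/

section Morita

universe u v w

/-- `E` is a `B`-`C` imprimitivity bimodule: a complete `B`-`C` bimodule with a `B`-valued inner
product (linear in the first variable) and a `C`-valued inner product (linear in the second
variable), both of which are full and induce the norm, such that `B` and `C` act by adjointable
operators and `⟨x, y⟩_B z = x ⟨y, z⟩_C`. -/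
structure ImprimitivityBimodule (B : Type u) (C : Type v) (E : Type w)
    [NonUnitalCStarAlgebra B] [NonUnitalCStarAlgebra C]
    [NormedAddCommGroup E] [NormedSpace ℂ E] where
  complete : CompleteSpace E
  /-- the left action of `B` -/
  lact : B →ₗ[ℂ] E →ₗ[ℂ] E
  /-- the right action of `C` -/
  ract : C →ₗ[ℂ] E →ₗ[ℂ] E
  lact_mul : ∀ b b' x, lact (b * b') x = lact b (lact b' x)
  ract_mul : ∀ c c' x, ract (c * c') x = ract c' (ract c x)
  lact_ract : ∀ b c x, lact b (ract c x) = ract c (lact b x)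
  /-- the `B`-valued inner product -/
  linner : E → E → B
  /-- the `C`-valued inner product -/
  rinner : E → E → C
  linner_add : ∀ x y z, linner (x + y) z = linner x z + linner y z
  linner_smul : ∀ (a : ℂ) x y, linner (a • x) y = a • linner x y
  linner_lact : ∀ b x y, linner (lact b x) y = b * linner x y
  star_linner : ∀ x y, star (linner x y) = linner y x
  linner_self_nonneg : ∀ x, ∃ b, linner x x = star b * b
  norm_linner_self : ∀ x, ‖linner x x‖ = ‖x‖ ^ 2
  linner_full : Dense (Submodule.span ℂ {b | ∃ x y, b = linner x y} : Set B)
  rinner_add : ∀ x y z, rinner x (y + z) = rinner x y + rinner x z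
  rinner_smul : ∀ (a : ℂ) x y, rinner x (a • y) = a • rinner x y
  rinner_ract : ∀ c x y, rinner x (ract c y) = rinner x y * c
  star_rinner : ∀ x y, star (rinner x y) = rinner y x
  rinner_self_nonneg : ∀ x, ∃ c, rinner x x = star c * c
  norm_rinner_self : ∀ x, ‖rinner x x‖ = ‖x‖ ^ 2
  rinner_full : Dense (Submodule.span ℂ {c | ∃ x y, c = rinner x y} : Set C)
  rinner_lact : ∀ b x y, rinner (lact b x) y = rinner x (lact (star b) y)
  linner_ract : ∀ c x y, linner (ract c x) y = linner x (ract (star c) y)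
  lact_linner : ∀ x y z, lact (linner x y) z = ract (rinner y z) x

/-- Strong Morita equivalence of C*-algebras. -/
def StronglyMoritaEquivalent (B : Type u) (C : Type v)
    [NonUnitalCStarAlgebra B] [NonUnitalCStarAlgebra C] : Prop :=
  ∃ (E : Type (max u v)) (_ : NormedAddCommGroup E) (_ : NormedSpace ℂ E),
    Nonempty (ImprimitivityBimodule B C E)

end Morita

universe u v w

/-! ### Cocycles, twisted group algebras, coactions -/

/-- Normalized `U(1)`-valued 2-cocycles on `Γ`. -/
structure TwoCocycle (Γ : Type u) [Group Γ] where
  /-- the underlying function -/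
  toFun : Γ → Γ → Circle
  cocycle : ∀ g₀ g₁ g₂, toFun g₀ g₁ * toFun (g₀ * g₁) g₂ = toFun g₁ g₂ * toFun g₀ (g₁ * g₂)
  map_one_right : ∀ g, toFun g 1 = 1
  map_one_left : ∀ g, toFun 1 g = 1

/-- The complex conjugate cocycle. -/
def TwoCocycle.conj {Γ : Type u} [Group Γ] (ω : TwoCocycle Γ) : TwoCocycle Γ where
  toFun g h := (ω.toFun g h)⁻¹
  cocycle g₀ g₁ g₂ := by rw [← mul_inv, ← mul_inv, ω.cocycle]
  map_one_right g := by simp [ω.map_one_right]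
  map_one_left g := by simp [ω.map_one_left]

/-- The trivial cocycle. -/
def TwoCocycle.trivial (Γ : Type u) [Group Γ] : TwoCocycle Γ where
  toFun _ _ := 1
  cocycle _ _ _ := rfl
  map_one_right _ := rfl
  map_one_left _ := rfl

section Coaction

variable {Γ : Type u} [Group Γ]
variable {H : Type v} [NormedAddCommGroup H] [InnerProductSpace ℂ H] [CompleteSpace H]

variable (H) in
/-- The operator `λ^(ω)_g ⊗ 1` on `ℓ²(Γ) ⊗ H`, where `λ^(ω)_g δ_h = ω(g, h) δ_{gh}`. -/
def twistedTranslation (ω : TwoCocycle Γ) (g : Γ) : L2 Γ H →L[ℂ] L2 Γ H :=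
  (monomial (Equiv.mulLeft g) (ω.toFun g) : L2 Γ H ≃ₗᵢ[ℂ] L2 Γ H)

@[simp] theorem twistedTranslation_apply (ω : TwoCocycle Γ) (g : Γ) (f : L2 Γ H) (s : Γ) :
    twistedTranslation H ω g f s = (ω.toFun g (g⁻¹ * s) : ℂ) • f (g⁻¹ * s) := rfl

variable (H) in
/-- The operator `λ_g ⊗ 1` on `ℓ²(Γ) ⊗ H`, where `λ_g δ_h = δ_{gh}`. -/
def translation (g : Γ) : L2 Γ H →L[ℂ] L2 Γ H := twistedTranslation H (TwoCocycle.trivial Γ) g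

variable (H) in
/-- The twisted reduced group C*-algebra of `Γ`, acting on `ℓ²(Γ) ⊗ H` through the first leg.
For `H = ℂ` it is the twisted reduced group C*-algebra in its defining representation. -/
def twistedGroupAlgebra (ω : TwoCocycle Γ) :
    NonUnitalStarSubalgebra ℂ (L2 Γ H →L[ℂ] L2 Γ H) :=
  (NonUnitalStarAlgebra.adjoin ℂ (Set.range (twistedTranslation H ω))).topologicalClosure

variable (Γ H) in
/-- The reduced group C*-algebra of `Γ`, acting on `ℓ²(Γ) ⊗ H` through the first leg. -/
def reducedGroupAlgebra : NonUnitalStarSubalgebra ℂ (L2 Γ H →L[ℂ] L2 Γ H) :=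
  twistedGroupAlgebra H (TwoCocycle.trivial Γ)

variable {A : Type w} [NonUnitalCStarAlgebra A]

/-- `π` is a faithful nondegenerate representation of `A` on `H`. -/
structure IsFaithfulNondegenerate (π : A →⋆ₙₐ[ℂ] (H →L[ℂ] H)) : Prop where
  injective : Function.Injective π
  nondegenerate : Dense (Submodule.span ℂ {v | ∃ a ξ, v = π a ξ} : Set H)

variable (Γ) in
/-- The minimal tensor product of the reduced group C*-algebra of `Γ` and `A`, acting on
`ℓ²(Γ) ⊗ H`: the C*-algebra generated by the `c ⊗ π a = (c ⊗ 1)(1 ⊗ π a)`. -/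
def minTensor (π : A →⋆ₙₐ[ℂ] (H →L[ℂ] H)) : NonUnitalStarSubalgebra ℂ (L2 Γ H →L[ℂ] L2 Γ H) :=
  (NonUnitalStarAlgebra.adjoin ℂ
    {T | ∃ c ∈ reducedGroupAlgebra Γ H, ∃ a, T = c * ampl Γ (π a)}).topologicalClosure

/-- The unitary `δ_h ⊗ δ_k ↦ δ_{kh} ⊗ δ_k` on `ℓ²(Γ) ⊗ ℓ²(Γ) ⊗ H`. -/
def comultUnitary : L2 (Γ × Γ) H ≃ₗᵢ[ℂ] L2 (Γ × Γ) H :=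
  monomial
    { toFun := fun p => (p.2 * p.1, p.2)
      invFun := fun p => (p.2⁻¹ * p.1, p.2)
      left_inv := fun p => by simp
      right_inv := fun p => by simp } 1

/-- The map `δ ⊗ ι`, where `δ(λ_g) = λ_g ⊗ λ_g` is the coproduct, in its spatial form, which is
defined on all operators on `ℓ²(Γ) ⊗ H` and in particular on the multipliers of `minTensor Γ π`. -/
def comult (T : L2 Γ H →L[ℂ] L2 Γ H) : L2 (Γ × Γ) H →L[ℂ] L2 (Γ × Γ) H :=
  comultUnitary.conjStarAlgEquiv (amplL Γ T)

/-- `(δ ⊗ ι)(λ_g ⊗ T) = λ_g ⊗ λ_g ⊗ T`. -/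
theorem comult_translation_mul (g : Γ) (T : H →L[ℂ] H) :
    unflatten (comult (translation H g * ampl Γ T)) =
      translation (L2 Γ H) g * ampl Γ (translation H g * ampl Γ T) := by
  ext f s t
  simp [unflatten, comult, comultUnitary, amplL_apply, translation, twistedTranslation,
    TwoCocycle.trivial, mul_assoc]

/-- For a `*`-homomorphism `φ` from `A` to `B(K)`, the relation `(ι ⊗ φ)(T) = S`, where `T` lies in
`minTensor Γ π`: slicing the first leg of `S` gives the image under `φ` of the corresponding slice
of `T`. -/
def IsIdTensor {K : Type*} [NormedAddCommGroup K] [InnerProductSpace ℂ K] [CompleteSpace K]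
    (π : A →⋆ₙₐ[ℂ] (H →L[ℂ] H)) (φ : A →⋆ₙₐ[ℂ] (K →L[ℂ] K))
    (T : L2 Γ H →L[ℂ] L2 Γ H) (S : L2 Γ K →L[ℂ] L2 Γ K) : Prop :=
  ∀ s t, ∃ a, π a = entry T s t ∧ φ a = entry S s t

/-- The relation `(ι ⊗ φ)(T) = S` for multipliers `T` of `minTensor Γ π`, where `φ` is extended to
the multiplier algebra of `A` by `φ(m) φ(a) = φ(m a)`. -/
def IsIdTensorMultiplier {K : Type*} [NormedAddCommGroup K] [InnerProductSpace ℂ K]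
    [CompleteSpace K] (π : A →⋆ₙₐ[ℂ] (H →L[ℂ] H)) (φ : A →⋆ₙₐ[ℂ] (K →L[ℂ] K))
    (T : L2 Γ H →L[ℂ] L2 Γ H) (S : L2 Γ K →L[ℂ] L2 Γ K) : Prop :=
  ∀ s t, ∀ a, ∃ b, π b = entry T s t * π a ∧ φ b = entry S s t * φ a

theorem entry_translation_mul (g : Γ) (T : H →L[ℂ] H) (s t : Γ) [Decidable (s = g * t)] :
    entry (translation H g * ampl Γ T) s t = if s = g * t then T else 0 := by
  classical
  ext v
  rw [entry_apply]
  by_cases h : s = g * t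
  · subst h
    simp [translation, twistedTranslation, TwoCocycle.trivial]
  · have h' : g⁻¹ * s ≠ t := fun h' => h (by simp [← h'])
    simp [translation, twistedTranslation, TwoCocycle.trivial, h, h']

/-- `(ι ⊗ φ)(λ_g ⊗ π a) = λ_g ⊗ φ a`. -/
theorem isIdTensor_translation_mul {K : Type*} [NormedAddCommGroup K] [InnerProductSpace ℂ K]
    [CompleteSpace K] (π : A →⋆ₙₐ[ℂ] (H →L[ℂ] H)) (φ : A →⋆ₙₐ[ℂ] (K →L[ℂ] K)) (g : Γ) (a : A) :
    IsIdTensor π φ (translation H g * ampl Γ (π a)) (translation K g * ampl Γ (φ a)) := by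
  classical
  intro s t
  refine ⟨if s = g * t then a else 0, ?_, ?_⟩ <;>
  · rw [entry_translation_mul]
    split_ifs <;> simp

/-- There is at most one `S` with `(ι ⊗ φ)(T) = S`. -/
theorem IsIdTensor.unique {K : Type*} [NormedAddCommGroup K] [InnerProductSpace ℂ K]
    [CompleteSpace K] {π : A →⋆ₙₐ[ℂ] (H →L[ℂ] H)} (hπ : IsFaithfulNondegenerate π)
    {φ : A →⋆ₙₐ[ℂ] (K →L[ℂ] K)} {T : L2 Γ H →L[ℂ] L2 Γ H} {S S' : L2 Γ K →L[ℂ] L2 Γ K}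
    (h : IsIdTensor π φ T S) (h' : IsIdTensor π φ T S') : S = S' := by
  refine ext_entry fun s t => ?_
  obtain ⟨a, ha, hS⟩ := h s t
  obtain ⟨b, hb, hS'⟩ := h' s t
  rw [← hS, ← hS', hπ.injective (ha.trans hb.symm)]

/-- `α` is a (continuous) coaction of the reduced group C*-algebra of `Γ` on `A`. -/
structure IsCoaction (π : A →⋆ₙₐ[ℂ] (H →L[ℂ] H)) (α : A →⋆ₙₐ[ℂ] (L2 Γ H →L[ℂ] L2 Γ H)) :
    Prop where
  mem : ∀ a, α a ∈ minTensor Γ π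
  /-- `(ι ⊗ α) ∘ α = (δ ⊗ ι) ∘ α` -/
  coassoc : ∀ a, IsIdTensor π α (α a) (unflatten (comult (α a)))
  /-- the span of the `(c ⊗ 1) α(a)` is dense -/
  cancellation : closure (Submodule.span ℂ {T | ∃ c ∈ reducedGroupAlgebra Γ H, ∃ a, T = c * α a} :
    Set (L2 Γ H →L[ℂ] L2 Γ H)) = minTensor Γ π

/-- `X` is a multiplier of `minTensor Γ π`. -/
def IsMultiplier (π : A →⋆ₙₐ[ℂ] (H →L[ℂ] H)) (X : L2 Γ H →L[ℂ] L2 Γ H) : Prop :=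
  ∀ T ∈ minTensor Γ π, X * T ∈ minTensor Γ π ∧ T * X ∈ minTensor Γ π

/-- `X` is an `α`-cocycle: a unitary multiplier with `X₂₃ (ι ⊗ α)(X) = (δ ⊗ ι)(X)`. -/
structure IsCoactionCocycle (π : A →⋆ₙₐ[ℂ] (H →L[ℂ] H)) (α : A →⋆ₙₐ[ℂ] (L2 Γ H →L[ℂ] L2 Γ H))
    (X : L2 Γ H →L[ℂ] L2 Γ H) : Prop where
  unitary : X ∈ unitary (L2 Γ H →L[ℂ] L2 Γ H)
  multiplier : IsMultiplier π X
  cocycle : ∃ Y : L2 (Γ × Γ) H →L[ℂ] L2 (Γ × Γ) H,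
    IsIdTensorMultiplier π α X (unflatten Y) ∧ amplL Γ X * Y = comult X

/-- `X` is an `α`-cocycle with `X α(a) X* = β(a)`. -/
structure IsExteriorEquivalence (π : A →⋆ₙₐ[ℂ] (H →L[ℂ] H))
    (α β : A →⋆ₙₐ[ℂ] (L2 Γ H →L[ℂ] L2 Γ H)) (X : L2 Γ H →L[ℂ] L2 Γ H) : Prop where
  isCocycle : IsCoactionCocycle π α X
  conj : ∀ a, X * α a * star X = β a

/-- The coactions `α` and `β` are exterior equivalent. -/
def ExteriorEquivalent (π : A →⋆ₙₐ[ℂ] (H →L[ℂ] H))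
    (α β : A →⋆ₙₐ[ℂ] (L2 Γ H →L[ℂ] L2 Γ H)) : Prop :=
  ∃ X, IsExteriorEquivalence π α β X

/-! ### Braided tensor products and deformed algebras

Operators on `ℓ²(Γ) ⊗ A ⊗ ℓ²(Γ)` are realised on `ℓ²(Γ × Γ) ⊗ H`; the index `(h, k)` stands for
`δ_h` in the first and `δ_k` in the third leg. -/

/-- The regular `ω`-representation unitary `W^(ω)` in the legs 1 and 3,
`δ_h ⊗ δ_k ↦ ω(h, k) δ_h ⊗ δ_{hk}`. -/
def regularUnitary (ω : TwoCocycle Γ) : L2 (Γ × Γ) H ≃ₗᵢ[ℂ] L2 (Γ × Γ) H :=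
  monomial
    { toFun := fun p => (p.1, p.1 * p.2)
      invFun := fun p => (p.1, p.1⁻¹ * p.2)
      left_inv := fun p => by simp
      right_inv := fun p => by simp } (fun p => ω.toFun p.1 p.2)

/-- The map `x ↦ ∑_h δ_h ⊗ Ad_{h⁻¹}(x)` placed in the legs 1 and 3, which is implemented by the
regular `ω`-representation unitary: `x ↦ W* (1 ⊗ x) W`. -/
def adTilde (ω : TwoCocycle Γ) (x : L2 Γ H →L[ℂ] L2 Γ H) : L2 (Γ × Γ) H →L[ℂ] L2 (Γ × Γ) H :=
  (regularUnitary ω).symm.conjStarAlgEquiv (amplL Γ x)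

theorem twistedTranslation_inv_mul (ω : TwoCocycle Γ) (h : Γ) :
    twistedTranslation H ω h⁻¹ * twistedTranslation H ω h =
      (ω.toFun h⁻¹ h : ℂ) • (1 : L2 Γ H →L[ℂ] L2 Γ H) := by
  ext f s
  have := congrArg (fun z : Circle => (z : ℂ)) (ω.cocycle h⁻¹ h s)
  simp only [inv_mul_cancel, ω.map_one_left, mul_one, Circle.coe_mul] at this
  simp [smul_smul, this, mul_comm]

theorem star_twistedTranslation (ω : TwoCocycle Γ) (h : Γ) :
    star (twistedTranslation H ω h) =
      ((monomial (Equiv.mulLeft h) (ω.toFun h) : L2 Γ H ≃ₗᵢ[ℂ] L2 Γ H).symm :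
        L2 Γ H →L[ℂ] L2 Γ H) :=
  LinearIsometryEquiv.adjoint_eq_symm _

theorem twistedTranslation_inv (ω : TwoCocycle Γ) (h : Γ) :
    twistedTranslation H ω h⁻¹ = (ω.toFun h⁻¹ h : ℂ) • star (twistedTranslation H ω h) := by
  have h1 : twistedTranslation H ω h * star (twistedTranslation H ω h) = 1 := by
    rw [star_twistedTranslation]
    ext f s
    simp
  calc twistedTranslation H ω h⁻¹
      = twistedTranslation H ω h⁻¹ * twistedTranslation H ω h *
          star (twistedTranslation H ω h) := by rw [mul_assoc, h1, mul_one]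
    _ = _ := by rw [twistedTranslation_inv_mul, smul_mul_assoc, one_mul]

/-- The component at `h` of `adTilde ω x` is `Ad_{h⁻¹}(x)`. -/
theorem adTilde_apply (ω : TwoCocycle Γ) (x : L2 Γ H →L[ℂ] L2 Γ H) (f : L2 (Γ × Γ) H) (h : Γ) :
    curry (adTilde ω x f) h =
      (twistedTranslation H ω h⁻¹ * x * star (twistedTranslation H ω h⁻¹)) (curry f h) := by
  have h1 : twistedTranslation H ω h⁻¹ * x * star (twistedTranslation H ω h⁻¹) =
      star (twistedTranslation H ω h) * x * twistedTranslation H ω h := by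
    rw [twistedTranslation_inv, star_smul, star_star, smul_mul_assoc, smul_mul_assoc,
      mul_smul_comm, smul_smul]
    simp [Complex.mul_conj]
  have h2 : curry (regularUnitary ω f) h = twistedTranslation H ω h (curry f h) := by
    ext k
    simp [regularUnitary]
  rw [h1, star_twistedTranslation]
  ext k
  simp only [mul_apply_eq_comp, ← h2]
  simp [adTilde, amplL_apply, regularUnitary]

/-- The braided tensor product of `A` (with the coaction `α`) and the twisted group algebra for
`ω`: the C*-algebra generated by the `α(a)₁₂ adTilde(x)₁₃`. -/
def braidedTensor (α : A →⋆ₙₐ[ℂ] (L2 Γ H →L[ℂ] L2 Γ H)) (ω : TwoCocycle Γ) :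
    NonUnitalStarSubalgebra ℂ (L2 (Γ × Γ) H →L[ℂ] L2 (Γ × Γ) H) :=
  (NonUnitalStarAlgebra.adjoin ℂ
    {T | ∃ a, ∃ x ∈ twistedGroupAlgebra H ω, T = amplR Γ (α a) * adTilde ω x}).topologicalClosure

/-- The unitary `δ_r ⊗ δ_s ⊗ δ_t ↦ δ_{str} ⊗ δ_s ⊗ δ_t`. -/
def diagUnitary : L2 (Γ × (Γ × Γ)) H ≃ₗᵢ[ℂ] L2 (Γ × (Γ × Γ)) H :=
  monomial
    { toFun := fun p => (p.2.1 * p.2.2 * p.1, p.2)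
      invFun := fun p => ((p.2.1 * p.2.2)⁻¹ * p.1, p.2)
      left_inv := fun p => by simp [mul_assoc]
      right_inv := fun p => by simp [mul_assoc] } 1

variable (Γ H) in
/-- The diagonal coaction on the braided tensor products, in its spatial form. -/
def diagCoaction : (L2 (Γ × Γ) H →L[ℂ] L2 (Γ × Γ) H) →⋆ₐ[ℂ]
    (L2 (Γ × (Γ × Γ)) H →L[ℂ] L2 (Γ × (Γ × Γ)) H) :=
  (diagUnitary (Γ := Γ) (H := H)).conjStarAlgEquiv.toStarAlgHom.comp (amplLHom (Γ × Γ) Γ H)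

/-- The diagonal coaction maps `T₁₂` to `(δ ⊗ ι)(T)₁₂₃`. -/
theorem diagCoaction_amplR (T : L2 Γ H →L[ℂ] L2 Γ H) :
    diagCoaction Γ H (amplR Γ T) =
      (monomial (Equiv.prodAssoc Γ Γ Γ) 1).conjStarAlgEquiv (amplR Γ (comult T)) := by
  ext f p
  obtain ⟨r, s, t⟩ := p
  have key : column (curry (diagUnitary.symm f) ((s * t)⁻¹ * r)) t =
      curry (comultUnitary.symm
        (column ((monomial (Equiv.prodAssoc Γ Γ Γ) 1).symm f) t)) (s⁻¹ * r) := by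
    ext i
    simp [diagUnitary, comultUnitary, mul_assoc]
  have h1 : diagCoaction Γ H (amplR Γ T) f (r, s, t) =
      amplR Γ T (curry (diagUnitary.symm f) ((s * t)⁻¹ * r)) (s, t) := by
    simp [diagCoaction, diagUnitary, amplLHom_apply]
  rw [h1, amplR_apply]
  simp only [LinearIsometryEquiv.conjStarAlgEquiv_apply_apply, monomial_apply, amplR_apply]
  simp only [comult, LinearIsometryEquiv.conjStarAlgEquiv_apply_apply]
  rw [key]
  simp [comultUnitary, amplL_apply]

/-- The diagonal coaction maps `adTilde(λ^(ω)_g)₁₃` to `λ_g ⊗ adTilde(λ^(ω)_g)₂₄`. -/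
theorem diagCoaction_adTilde (ω : TwoCocycle Γ) (g : Γ) :
    unflatten (diagCoaction Γ H (adTilde ω (twistedTranslation H ω g))) =
      translation (L2 (Γ × Γ) H) g * ampl Γ (adTilde ω (twistedTranslation H ω g)) := by
  ext f r p
  obtain ⟨s, t⟩ := p
  simp [unflatten, diagCoaction, diagUnitary, amplLHom_apply, adTilde, amplL_apply, regularUnitary,
    translation, TwoCocycle.trivial, mul_assoc]

/-- The deformation of `A` with respect to `α` and `ω`: the fixed point algebra of the diagonal
coaction on the braided tensor product of `A` and the twisted group algebra for `conj ω`. -/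
def deformation (α : A →⋆ₙₐ[ℂ] (L2 Γ H →L[ℂ] L2 Γ H)) (ω : TwoCocycle Γ) :
    NonUnitalStarSubalgebra ℂ (L2 (Γ × Γ) H →L[ℂ] L2 (Γ × Γ) H) :=
  braidedTensor α ω.conj ⊓
    NonUnitalStarAlgHom.equalizer (diagCoaction Γ H) (amplLHom (Γ × Γ) Γ H)

instance isClosed_deformation (α : A →⋆ₙₐ[ℂ] (L2 Γ H →L[ℂ] L2 Γ H)) (ω : TwoCocycle Γ) :
    IsClosed (deformation α ω : Set (L2 (Γ × Γ) H →L[ℂ] L2 (Γ × Γ) H)) := by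
  refine (NonUnitalStarSubalgebra.isClosed_topologicalClosure _).inter ?_
  exact isClosed_eq (map_continuous (diagCoaction Γ H)) (map_continuous (amplLHom (Γ × Γ) Γ H))

/-- The space of all `x = y X₁₂*` with `y` in the braided tensor product of `A` (with the coaction
`α`) and the twisted group algebra for `conj ω`, such that `x` is fixed by the diagonal coaction. -/
def cocycleBimodule (α : A →⋆ₙₐ[ℂ] (L2 Γ H →L[ℂ] L2 Γ H)) (ω : TwoCocycle Γ)
    (X : L2 Γ H →L[ℂ] L2 Γ H) : Submodule ℂ (L2 (Γ × Γ) H →L[ℂ] L2 (Γ × Γ) H) where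
  carrier := {x | (∃ y ∈ braidedTensor α ω.conj, x = y * star (amplR Γ X)) ∧
    diagCoaction Γ H x = amplL Γ x}
  zero_mem' := ⟨⟨0, zero_mem _, by simp⟩, by simp [amplL]⟩
  add_mem' := by
    rintro _ _ ⟨⟨y, hy, rfl⟩, h⟩ ⟨⟨y', hy', rfl⟩, h'⟩
    refine ⟨⟨y + y', add_mem hy hy', by rw [add_mul]⟩, ?_⟩
    simp only [amplL, map_add] at h h' ⊢
    rw [h, h']
  smul_mem' := by
    rintro c _ ⟨⟨y, hy, rfl⟩, h⟩
    refine ⟨⟨c • y, SMulMemClass.smul_mem c hy, by rw [smul_mul_assoc]⟩, ?_⟩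
    simp only [amplL, map_smul] at h ⊢
    rw [h]

end Coaction

end Coact

end

/-! All algebraic identities of the bimodule hold because everything consists of operators on one
Hilbert space. What needs proof is that the products stay in the right algebras and that both inner
products are full.

The key is a grading of `A` twisted by `X`. Call `b` homogeneous of degree `g` if `X α(b) = λ_g ⊗
b`. The cocycle identity and the coaction identity give `(δ ⊗ ι)(X α(a)) = X₂₃ (ι ⊗ α)(X α(a))`, so
slicing the first leg of `X α(a)` produces homogeneous elements
(`IsCoactionCocycle.exists_slice_mem_spectralSet`). Since `X α(a) = β(a) X`, the cancellation
property of `β` shows that they span a dense subspace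
(`IsExteriorEquivalence.mem_closedSpan_spectralSet`). From there on only `IsGradedTwist` is used; it
is symmetric under `(α, β, X) ↦ (β, α, X*)`, and it implies the same statement for `(α, α, 1)`.

On homogeneous elements the braided commutation relation is explicit: `adTilde(λ_k)₁₃` passes
through `(λ_g ⊗ T)₁₂` at the cost of conjugating `k` and a phase. Hence the closed span of the
`α(a)₁₂ adTilde(λ_k)₁₃` is already the braided tensor product, and conjugation by `X₁₂*` carries the
one for `β` into the one for `α` (`conj_mem_braidedTensor`). So `E_X` is a bimodule, and its adjoint
is the bimodule of `X*`.

For fullness (`mem_closedSpan_mul_star`), apply the expectation onto the fixed points to `α(c* b)₁₂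
adTilde(λ_k)₁₃` with `c` of degree `m` and `b` of degree `n`. With `U = adTilde(λ_{m⁻¹})₁₃` this is
`(U X₁₂ α(c)₁₂)* (U X₁₂ α(b)₁₂ adTilde(λ_k)₁₃)`, whose first factor has degree `1`. Either the
second does too, and both are adjoints of elements of `E_X`, or the expectation kills the product.
-/

namespace Coact

/-! ### Closed linear spans and continuous maps. -/

section ClosedSpan

variable {E F G : Type*} [NormedAddCommGroup E] [NormedSpace ℂ E] [NormedAddCommGroup F]
  [NormedSpace ℂ F] [NormedAddCommGroup G] [NormedSpace ℂ G]

/-- The closed linear span of a set. -/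
def closedSpan (s : Set E) : Submodule ℂ E := (Submodule.span ℂ s).topologicalClosure

theorem coe_closedSpan (s : Set E) :
    (closedSpan s : Set E) = closure (Submodule.span ℂ s : Set E) := rfl

theorem isClosed_closedSpan (s : Set E) : IsClosed (closedSpan s : Set E) :=
  Submodule.isClosed_topologicalClosure _

theorem subset_closedSpan {s : Set E} {x : E} (hx : x ∈ s) : x ∈ closedSpan s :=
  Submodule.le_topologicalClosure _ (Submodule.subset_span hx)

theorem closedSpan_le {s : Set E} {W : Submodule ℂ E} (hW : IsClosed (W : Set E))
    (h : ∀ x ∈ s, x ∈ W) : closedSpan s ≤ W :=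
  Submodule.topologicalClosure_minimal _ (Submodule.span_le.2 h) hW

theorem mem_of_mem_closedSpan {σ : ℂ →+* ℂ} {s : Set E} {W : Submodule ℂ F}
    (hW : IsClosed (W : Set F)) (f : E →SL[σ] F) (h : ∀ x ∈ s, f x ∈ W) {x : E}
    (hx : x ∈ closedSpan s) : f x ∈ W :=
  closedSpan_le (W := W.comap f.toLinearMap) (hW.preimage f.continuous) h hx

theorem map_mem_closedSpan {σ : ℂ →+* ℂ} {s : Set E} {t : Set F} (f : E →SL[σ] F)
    (h : ∀ x ∈ s, f x ∈ closedSpan t) {x : E} (hx : x ∈ closedSpan s) : f x ∈ closedSpan t :=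
  mem_of_mem_closedSpan (isClosed_closedSpan t) f h hx

theorem map₂_mem_closedSpan {s : Set E} {t : Set F} {u : Set G} (f : E →L[ℂ] F →L[ℂ] G)
    (h : ∀ x ∈ s, ∀ y ∈ t, f x y ∈ closedSpan u) {x : E} (hx : x ∈ closedSpan s) {y : F}
    (hy : y ∈ closedSpan t) : f x y ∈ closedSpan u :=
  map_mem_closedSpan (f.flip y) (fun x hx => map_mem_closedSpan (f x) (h x hx) hy) hx

/-- Two continuous linear maps that agree on a set agree on its closed linear span. -/
theorem eq_of_mem_closedSpan {s : Set E} (f g : E →L[ℂ] F) (h : ∀ x ∈ s, f x = g x) {x : E}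
    (hx : x ∈ closedSpan s) : f x = g x := by
  have := mem_of_mem_closedSpan (W := (⊥ : Submodule ℂ F)) isClosed_singleton (f - g)
    (fun x hx => by simp [h x hx]) hx
  simpa [sub_eq_zero] using this

theorem mem_closedSpan_of_isometry (f : E →L[ℂ] F) (hf : Isometry f) {s : Set E} {x : E}
    (h : f x ∈ closedSpan (f '' s)) : x ∈ closedSpan s := by
  have h' : f x ∈ closure (f '' (Submodule.span ℂ s : Set E)) := by
    have h2 : f x ∈ closure (Submodule.span ℂ (f '' s) : Set F) := h
    have h3 : Submodule.span ℂ (f '' s) = (Submodule.span ℂ s).map f.toLinearMap :=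
      Submodule.span_image f.toLinearMap
    rw [h3] at h2
    exact h2
  rw [← SetLike.mem_coe, coe_closedSpan,
    hf.isUniformInducing.isInducing.closure_eq_preimage_closure_image]
  exact h'

/-- The uniform bound makes the subspace of vectors with `Q i x → 0` closed, by an `ε/2` argument.
-/
theorem tendsto_zero_of_mem_closedSpan {ι : Type*} {l : Filter ι} (Q : ι → E →L[ℂ] F) (C : ℝ)
    (hQ : ∀ i x, ‖Q i x‖ ≤ C * ‖x‖) {s : Set E}
    (hs : ∀ x ∈ s, Filter.Tendsto (fun i => Q i x) l (nhds 0)) {x : E} (hx : x ∈ closedSpan s) :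
    Filter.Tendsto (fun i => Q i x) l (nhds 0) := by
  let W : Submodule ℂ E :=
    { carrier := {x | Filter.Tendsto (fun i => Q i x) l (nhds 0)}
      zero_mem' := by simpa using tendsto_const_nhds
      add_mem' := fun hx hy => by simpa using Filter.Tendsto.add hx hy
      smul_mem' := fun c x hx => by simpa using Filter.Tendsto.const_smul hx c }
  refine closedSpan_le (W := W) (isClosed_of_closure_subset fun x hx => ?_) hs hx
  refine Metric.tendsto_nhds.2 fun ε hε => ?_
  obtain ⟨y, hy, hd⟩ := Metric.mem_closure_iff.1 hx (ε / 2 / (|C| + 1)) (by positivity)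
  have h1 : ∀ i, ‖Q i (x - y)‖ < ε / 2 := fun i => by
    rw [dist_eq_norm, lt_div_iff₀ (by positivity)] at hd
    have : C * ‖x - y‖ ≤ |C| * ‖x - y‖ := by gcongr; exact le_abs_self C
    linarith [hQ i (x - y), norm_nonneg (x - y)]
  filter_upwards [Metric.tendsto_nhds.1 hy (ε / 2) (half_pos hε)] with i hi
  rw [dist_zero_right] at hi ⊢
  calc ‖Q i x‖ = ‖Q i (x - y) + Q i y‖ := by rw [map_sub, sub_add_cancel]
    _ ≤ ‖Q i (x - y)‖ + ‖Q i y‖ := norm_add_le _ _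
    _ < ε := by linarith [h1 i]

end ClosedSpan

/-! ### Closed spans in C*-algebras. -/

section CStar

variable {B : Type*} [NonUnitalCStarAlgebra B]

theorem mul_left_mem_closedSpan {s t : Set B} (a : B) (h : ∀ x ∈ s, a * x ∈ closedSpan t) {x : B}
    (hx : x ∈ closedSpan s) : a * x ∈ closedSpan t :=
  map_mem_closedSpan (ContinuousLinearMap.mul ℂ B a) h hx

theorem mul_right_mem_closedSpan {s t : Set B} (a : B) (h : ∀ x ∈ s, x * a ∈ closedSpan t) {x : B}
    (hx : x ∈ closedSpan s) : x * a ∈ closedSpan t :=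
  map_mem_closedSpan ((ContinuousLinearMap.mul ℂ B).flip a) h hx

theorem mul_mem_closedSpan {s t u : Set B} (h : ∀ x ∈ s, ∀ y ∈ t, x * y ∈ closedSpan u) {x : B}
    (hx : x ∈ closedSpan s) {y : B} (hy : y ∈ closedSpan t) : x * y ∈ closedSpan u :=
  map₂_mem_closedSpan (ContinuousLinearMap.mul ℂ B) h hx hy

theorem star_mem_closedSpan {s t : Set B} (h : ∀ x ∈ s, star x ∈ closedSpan t) {x : B}
    (hx : x ∈ closedSpan s) : star x ∈ closedSpan t :=
  map_mem_closedSpan (starL ℂ : B ≃L⋆[ℂ] B).toContinuousLinearMap h hx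

/-- The hypotheses on `t` make its closed span a C*-subalgebra. This replaces a generated algebra by
a linear span, on which continuous linear maps can be checked. -/
theorem topologicalClosure_adjoin_le {s t : Set B} (hs : ∀ x ∈ s, x ∈ closedSpan t)
    (hmul : ∀ x ∈ t, ∀ y ∈ t, x * y ∈ closedSpan t) (hstar : ∀ x ∈ t, star x ∈ closedSpan t)
    {x : B} (hx : x ∈ (NonUnitalStarAlgebra.adjoin ℂ s).topologicalClosure) :
    x ∈ closedSpan t := by
  let S : NonUnitalStarSubalgebra ℂ B :=
    { closedSpan t with
      mul_mem' := fun hx hy => mul_mem_closedSpan hmul hx hy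
      star_mem' := fun hx => star_mem_closedSpan hstar hx }
  exact NonUnitalStarSubalgebra.topologicalClosure_minimal (t := S) _
    (NonUnitalStarAlgebra.adjoin_le hs) (isClosed_closedSpan t) hx

/-- With an approximate unit `e`, `x = lim e x`, and each `e x = (e*)* x` is a limit of combinations
of products `b* c`. -/
theorem mem_closedSpan_star_mul {s : Set B} (hs : ∀ x : B, x ∈ closedSpan s) (x : B) :
    x ∈ closedSpan {z | ∃ b ∈ s, ∃ c ∈ s, z = star b * c} := by
  let _ := CStarAlgebra.spectralOrder B
  have := CStarAlgebra.spectralOrderedRing B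
  have hl := CStarAlgebra.increasingApproximateUnit B
  have h : ∀ y : B, y * x ∈ closedSpan {z | ∃ b ∈ s, ∃ c ∈ s, z = star b * c} := fun y => by
    rw [← star_star y]
    refine map_mem_closedSpan (σ := starRingEnd ℂ) (((ContinuousLinearMap.mul ℂ B).flip x).comp
      (starL ℂ : B ≃L⋆[ℂ] B).toContinuousLinearMap) (s := s) (fun b hb => ?_) (hs (star y))
    have hmem : ∀ c ∈ s, star b * c ∈ {z | ∃ b ∈ s, ∃ c ∈ s, z = star b * c} :=
      fun c hc => ⟨b, hb, c, hc, rfl⟩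
    exact mul_left_mem_closedSpan (star b) (fun c hc => subset_closedSpan (hmem c hc)) (hs x)
  have := (CStarAlgebra.increasingApproximateUnit B).neBot
  exact (isClosed_closedSpan _).mem_of_tendsto (hl.tendsto_mul_right x)
    (Filter.Eventually.of_forall h)

/-- Positivity passes from the ambient algebra to `S`: the square root, obtained by non-unital
functional calculus, stays in `S` even if `x` does not. -/
theorem exists_eq_star_mul_self (S : NonUnitalStarSubalgebra ℂ B) (hS : IsClosed (S : Set B))
    {x : B} (hx : star x * x ∈ S) : ∃ b ∈ S, star x * x = star b * b := by
  let _ := CStarAlgebra.spectralOrder B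
  have := CStarAlgebra.spectralOrderedRing B
  have h0 : 0 ≤ star x * x := star_mul_self_nonneg x
  have : IsClosed (S : Set B) := hS
  refine ⟨CFC.sqrt (star x * x), ?_, ?_⟩
  · rw [CFC.sqrt_eq_real_sqrt _ h0]
    exact cfcₙ_mem Real.sqrt hx
  · rw [(IsSelfAdjoint.of_nonneg (CFC.sqrt_nonneg (star x * x))).star_eq, CFC.sqrt_mul_sqrt_self _ h0]

theorem dense_span_of_mem_closedSpan {S : NonUnitalStarSubalgebra ℂ B} {s : Set S} {t : Set B}
    (ht : ∀ b ∈ S, b ∈ closedSpan t) (hs : ∀ b ∈ t, ∃ c ∈ s, (c : B) = b) :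
    Dense (Submodule.span ℂ s : Set S) := by
  intro b
  rw [Topology.IsInducing.subtypeVal.closure_eq_preimage_closure_image]
  refine closure_mono ?_ (ht b b.2)
  have h : Submodule.span ℂ t ≤ (Submodule.span ℂ s).map S.toSubmodule.subtype := by
    refine Submodule.span_le.2 fun z hz => ?_
    obtain ⟨c, hc, rfl⟩ := hs z hz
    exact ⟨c, Submodule.subset_span hc, rfl⟩
  exact h

theorem star_mul_mul (a b c : B) : star (a * b) * c = star b * (star a * c) := by
  rw [star_mul, mul_assoc]

theorem mul_mul_star (a b c : B) : b * a * star c = b * star (c * star a) := by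
  rw [star_mul, star_star, mul_assoc]

theorem star_mul_star (a b : B) : star (a * star b) = b * star a := by rw [star_mul, star_star]

theorem star_star_mul (a b : B) : star (star a * b) = star b * a := by rw [star_mul, star_star]

end CStar

end Coact

namespace Coact

/-! ### Matrix entries of operators and norm convergence of columns. -/

section Entries

variable {M I : Type*} {H : Type*} [NormedAddCommGroup H] [InnerProductSpace ℂ H]

open Classical in
/-- The map `T ↦ entry T s t` as a continuous linear map. -/
noncomputable def entryL (s t : M) : (L2 M H →L[ℂ] L2 M H) →L[ℂ] (H →L[ℂ] H) :=
  ((ContinuousLinearMap.compL ℂ H (L2 M H) H) (lp.evalCLM ℂ (fun _ : M => H) 2 s)).comp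
    ((ContinuousLinearMap.compL ℂ H (L2 M H) (L2 M H)).flip
      (lp.singleContinuousLinearMap ℂ (fun _ : M => H) 2 t))

theorem entryL_apply (s t : M) (T : L2 M H →L[ℂ] L2 M H) : entryL s t T = entry T s t := rfl

theorem hasSum_entry_mul_apply (S T : L2 M H →L[ℂ] L2 M H) (s t : M) (v : H) :
    HasSum (fun r => entry S s r (entry T r t v)) (entry (S * T) s t v) := by
  classical
  have hf := lp.hasSum_single (p := 2) (by norm_num) (T (lp.single 2 t v))
  have := hf.mapL (lp.evalCLM ℂ (fun _ : M => H) 2 s ∘L S)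
  exact this

open Classical in
/-- The column `t` of `T` is the norm convergent sum of its entries. -/
def HasColumnSum (T : L2 M H →L[ℂ] L2 M H) (t : M) : Prop :=
  HasSum (fun r => lp.singleContinuousLinearMap ℂ (fun _ : M => H) 2 r ∘L entry T r t)
    (T ∘L lp.singleContinuousLinearMap ℂ (fun _ : M => H) 2 t)

/-- In general the matrix product converges only strongly, as in `hasSum_entry_mul_apply`. Norm
convergence is what later allows a `*`-homomorphism to be applied term by term. -/
theorem HasColumnSum.hasSum_entry_mul {T : L2 M H →L[ℂ] L2 M H} {t : M} (h : HasColumnSum T t)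
    (S : L2 M H →L[ℂ] L2 M H) (s : M) :
    HasSum (fun r => entry S s r * entry T r t) (entry (S * T) s t) := by
  classical
  exact h.mapL (ContinuousLinearMap.compL ℂ H (L2 M H) H (lp.evalCLM ℂ (fun _ : M => H) 2 s ∘L S))

theorem L2.norm_sub_sum_single_le [DecidableEq M] (f : L2 M H) (F : Finset M) :
    ‖f - ∑ r ∈ F, lp.single 2 r (f r)‖ ≤ ‖f‖ := by
  have h := lp.norm_sub_norm_compl_sub_single (p := 2) (by norm_num) f F
  have h0 : 0 ≤ ∑ i ∈ F, ‖f i‖ ^ (2 : ENNReal).toReal := by positivity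
  simp only [ENNReal.toReal_ofNat, Real.rpow_ofNat] at h h0
  rw [← sq_le_sq₀ (norm_nonneg _) (norm_nonneg _)]
  linarith

theorem tendsto_comp_zero_of_mem_closedSpan {K : Type*} [NormedAddCommGroup K] [NormedSpace ℂ K]
    {ι : Type*} {l : Filter ι} (Q : ι → K →L[ℂ] K) (hQ : ∀ i x, ‖Q i x‖ ≤ ‖x‖) (j : H →L[ℂ] K)
    {s : Set (K →L[ℂ] K)} (hs : ∀ T ∈ s, Filter.Tendsto (fun i => Q i ∘L T ∘L j) l (nhds 0))
    {T : K →L[ℂ] K} (hT : T ∈ closedSpan s) :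
    Filter.Tendsto (fun i => Q i ∘L T ∘L j) l (nhds 0) := by
  refine tendsto_zero_of_mem_closedSpan (fun i => (ContinuousLinearMap.compL ℂ H K K (Q i)).comp
    ((ContinuousLinearMap.compL ℂ H K K).flip j)) ‖j‖ (fun i T => ?_) hs hT
  refine ContinuousLinearMap.opNorm_le_bound _ (by positivity) fun v => ?_
  calc ‖Q i (T (j v))‖ ≤ ‖T (j v)‖ := hQ i _
    _ ≤ ‖T‖ * (‖j‖ * ‖v‖) := (T.le_opNorm _).trans (by gcongr; exact j.le_opNorm v)
    _ = ‖j‖ * ‖T‖ * ‖v‖ := by ring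

open Classical in
/-- The projection of `ℓ²(M) ⊗ H` onto the families vanishing on a finite set. -/
noncomputable def complProj (F : Finset M) : L2 M H →L[ℂ] L2 M H :=
  ContinuousLinearMap.id ℂ (L2 M H) - ∑ r ∈ F,
    lp.singleContinuousLinearMap ℂ (fun _ : M => H) 2 r ∘L lp.evalCLM ℂ (fun _ : M => H) 2 r

open Classical in
theorem complProj_apply (F : Finset M) (f : L2 M H) :
    complProj F f = f - ∑ r ∈ F, lp.single 2 r (f r) := by
  simp only [complProj, sub_apply, sum_apply]
  rfl

theorem tendsto_const_sub_zero_iff {E ι : Type*} [TopologicalSpace E] [AddCommGroup E]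
    [IsTopologicalAddGroup E] {l : Filter ι} {f : ι → E} {a : E} :
    Filter.Tendsto (fun i => a - f i) l (nhds 0) ↔ Filter.Tendsto f l (nhds a) :=
  ⟨fun h => by simpa using (tendsto_const_nhds (x := a)).sub h,
    fun h => by simpa using (tendsto_const_nhds (x := a)).sub h⟩

open Classical in
theorem hasColumnSum_iff (T : L2 M H →L[ℂ] L2 M H) (t : M) :
    HasColumnSum T t ↔ Filter.Tendsto (fun F : Finset M =>
      complProj F ∘L T ∘L lp.singleContinuousLinearMap ℂ (fun _ : M => H) 2 t)
        Filter.atTop (nhds 0) := by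
  have h : ∀ F : Finset M, complProj F ∘L T ∘L lp.singleContinuousLinearMap ℂ (fun _ : M => H) 2 t =
      T ∘L lp.singleContinuousLinearMap ℂ (fun _ : M => H) 2 t -
      ∑ r ∈ F, lp.singleContinuousLinearMap ℂ (fun _ : M => H) 2 r ∘L entry T r t := fun F => by
    ext1 v
    simp only [ContinuousLinearMap.comp_apply, complProj_apply, sub_apply, sum_apply]
    rfl
  simp only [h]
  rw [tendsto_const_sub_zero_iff]
  rfl

/-- Convergence of the column means that its tails, cut off by the contractions `complProj F`, tend
to zero; this survives norm limits. -/
theorem hasColumnSum_of_mem_closedSpan {s : Set (L2 M H →L[ℂ] L2 M H)} {t : M}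
    (hs : ∀ T ∈ s, HasColumnSum T t) {T : L2 M H →L[ℂ] L2 M H} (hT : T ∈ closedSpan s) :
    HasColumnSum T t := by
  classical
  have h := fun T hT => (hasColumnSum_iff T t).1 (hs T hT)
  have hQ : ∀ (F : Finset M) (f : L2 M H), ‖complProj F f‖ ≤ ‖f‖ := fun F f => by
    rw [complProj_apply]
    exact L2.norm_sub_sum_single_le f F
  have := tendsto_comp_zero_of_mem_closedSpan (K := L2 M H) (H := H) (l := Filter.atTop)
    complProj hQ (lp.singleContinuousLinearMap ℂ (fun _ : M => H) 2 t) (s := s) h hT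
  exact (hasColumnSum_iff T t).2 this

end Entries

/-! ### The spatial maps as continuous `*`-homomorphisms. -/

section Homs

variable {M I Γ : Type*} [Group Γ] {H : Type*} [NormedAddCommGroup H] [InnerProductSpace ℂ H]
  [CompleteSpace H]

open scoped CStarAlgebra in
/-- A `*`-homomorphism between C*-algebras as a continuous linear map. -/
noncomputable def _root_.NonUnitalStarAlgHom.toCLM {B C : Type*} [NonUnitalCStarAlgebra B]
    [NonUnitalCStarAlgebra C] (f : B →⋆ₙₐ[ℂ] C) : B →L[ℂ] C :=
  ⟨{ toFun := f, map_add' := map_add f, map_smul' := map_smul f }, map_continuous f⟩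

@[simp] theorem _root_.NonUnitalStarAlgHom.toCLM_apply {B C : Type*} [NonUnitalCStarAlgebra B]
    [NonUnitalCStarAlgebra C] (f : B →⋆ₙₐ[ℂ] C) (b : B) : f.toCLM b = f b := rfl

/-- A unital `*`-homomorphism between C*-algebras as a continuous linear map. -/
noncomputable def _root_.StarAlgHom.toCLM {B C : Type*} [CStarAlgebra B] [CStarAlgebra C]
    (f : B →⋆ₐ[ℂ] C) : B →L[ℂ] C :=
  (f : B →⋆ₙₐ[ℂ] C).toCLM

@[simp] theorem _root_.StarAlgHom.toCLM_apply {B C : Type*} [CStarAlgebra B] [CStarAlgebra C]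
    (f : B →⋆ₐ[ℂ] C) (b : B) : f.toCLM b = f b := rfl

variable (M I H) in
/-- `amplR` as a `*`-homomorphism. -/
noncomputable def amplRHom :
    (L2 I H →L[ℂ] L2 I H) →⋆ₐ[ℂ] (L2 (I × M) H →L[ℂ] L2 (I × M) H) :=
  (monomial (H := H) (Equiv.prodComm M I) 1).conjStarAlgEquiv.toStarAlgHom.comp (amplLHom I M H)

variable (H) in
/-- `adTilde` as a `*`-homomorphism. -/
noncomputable def adTildeHom (ω : TwoCocycle Γ) :
    (L2 Γ H →L[ℂ] L2 Γ H) →⋆ₐ[ℂ] (L2 (Γ × Γ) H →L[ℂ] L2 (Γ × Γ) H) :=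
  (regularUnitary ω).symm.conjStarAlgEquiv.toStarAlgHom.comp (amplLHom Γ Γ H)

theorem adTildeHom_apply (ω : TwoCocycle Γ) (x : L2 Γ H →L[ℂ] L2 Γ H) :
    adTildeHom H ω x = adTilde ω x := rfl

variable (Γ H) in
/-- `unflatten ∘ comult` as a `*`-homomorphism. -/
noncomputable def comultHom :
    (L2 Γ H →L[ℂ] L2 Γ H) →⋆ₐ[ℂ] (L2 Γ (L2 Γ H) →L[ℂ] L2 Γ (L2 Γ H)) :=
  (curry (M := Γ) (I := Γ) (H := H)).conjStarAlgEquiv.toStarAlgHom.comp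
    ((comultUnitary (Γ := Γ) (H := H)).conjStarAlgEquiv.toStarAlgHom.comp (amplLHom Γ Γ H))

theorem comultHom_apply (T : L2 Γ H →L[ℂ] L2 Γ H) : comultHom Γ H T = unflatten (comult T) := rfl

variable (Γ H) in
/-- The diagonal coaction, with values in the operators on `ℓ²(Γ) ⊗ ℓ²(Γ × Γ) ⊗ H`. -/
noncomputable def diagHom : (L2 (Γ × Γ) H →L[ℂ] L2 (Γ × Γ) H) →⋆ₐ[ℂ]
    (L2 Γ (L2 (Γ × Γ) H) →L[ℂ] L2 Γ (L2 (Γ × Γ) H)) :=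
  curry.conjStarAlgEquiv.toStarAlgHom.comp (diagCoaction Γ H)

theorem diagHom_apply (T : L2 (Γ × Γ) H →L[ℂ] L2 (Γ × Γ) H) :
    diagHom Γ H T = unflatten (diagCoaction Γ H T) := rfl

theorem unflatten_mul (S T : L2 (M × I) H →L[ℂ] L2 (M × I) H) :
    unflatten (S * T) = unflatten S * unflatten T := map_mul _ _ _

theorem unflatten_amplL (T : L2 I H →L[ℂ] L2 I H) : unflatten (amplL M T) = ampl M T := by
  ext f m i
  simp [unflatten, amplL_apply]

theorem unflatten_injective :
    Function.Injective (unflatten : (L2 (M × I) H →L[ℂ] L2 (M × I) H) → _) :=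
  (curry (M := M) (I := I) (H := H)).conjStarAlgEquiv.injective

theorem diagCoaction_eq_iff (T : L2 (Γ × Γ) H →L[ℂ] L2 (Γ × Γ) H) :
    diagCoaction Γ H T = amplL Γ T ↔ diagHom Γ H T = ampl Γ T := by
  rw [diagHom_apply, ← unflatten_amplL, unflatten_injective.eq_iff]

end Homs

/-! ### The operators `λ_g ⊗ T` and slices of the minimal tensor product. -/

section Translations

variable {Γ : Type*} [Group Γ] {H : Type*} [NormedAddCommGroup H] [InnerProductSpace ℂ H]
  [CompleteSpace H] {A : Type*} [NonUnitalCStarAlgebra A]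

theorem twistedTranslation_mul (ω : TwoCocycle Γ) (g h : Γ) :
    twistedTranslation H ω g * twistedTranslation H ω h =
      (ω.toFun g h : ℂ) • twistedTranslation H ω (g * h) := by
  ext f s
  have := congrArg (fun z : Circle => (z : ℂ)) (ω.cocycle g h (h⁻¹ * (g⁻¹ * s)))
  simp only [Circle.coe_mul, mul_inv_cancel_left] at this
  simp [smul_smul, this, mul_comm, mul_assoc]

theorem twistedTranslation_one (ω : TwoCocycle Γ) : twistedTranslation H ω 1 = 1 := by
  ext f s
  simp [ω.map_one_left]

theorem star_mul_twistedTranslation (ω : TwoCocycle Γ) (g : Γ) :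
    star (twistedTranslation H ω g) * twistedTranslation H ω g = 1 := by
  rw [star_twistedTranslation]
  ext f s
  simp

theorem twistedTranslation_mul_star (ω : TwoCocycle Γ) (g : Γ) :
    twistedTranslation H ω g * star (twistedTranslation H ω g) = 1 := by
  rw [star_twistedTranslation]
  ext f s
  simp

theorem exists_star_twistedTranslation (ω : TwoCocycle Γ) (g : Γ) :
    ∃ c : ℂ, star (twistedTranslation H ω g) = c • twistedTranslation H ω g⁻¹ := by
  refine ⟨((ω.toFun g⁻¹ g)⁻¹ : Circle), ?_⟩
  rw [twistedTranslation_inv, smul_smul, ← Circle.coe_mul]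
  simp

theorem mem_closedSpan_of_mem_twistedGroupAlgebra {ω : TwoCocycle Γ} {x : L2 Γ H →L[ℂ] L2 Γ H}
    (hx : x ∈ twistedGroupAlgebra H ω) : x ∈ closedSpan (Set.range (twistedTranslation H ω)) := by
  refine topologicalClosure_adjoin_le (fun x hx => subset_closedSpan hx) ?_ ?_ hx
  · rintro _ ⟨g, rfl⟩ _ ⟨h, rfl⟩
    rw [twistedTranslation_mul]
    exact Submodule.smul_mem _ _ (subset_closedSpan ⟨_, rfl⟩)
  · rintro _ ⟨g, rfl⟩
    obtain ⟨c, hc⟩ := exists_star_twistedTranslation (H := H) ω g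
    rw [hc]
    exact Submodule.smul_mem _ _ (subset_closedSpan ⟨_, rfl⟩)

theorem twistedTranslation_mem (ω : TwoCocycle Γ) (g : Γ) :
    twistedTranslation H ω g ∈ twistedGroupAlgebra H ω :=
  NonUnitalStarSubalgebra.le_topologicalClosure _
    (NonUnitalStarAlgebra.subset_adjoin ℂ _ ⟨g, rfl⟩)

theorem translation_mul (g h : Γ) : translation H g * translation H h = translation H (g * h) := by
  simp [translation, twistedTranslation_mul, TwoCocycle.trivial]

theorem translation_one : translation H (1 : Γ) = 1 := twistedTranslation_one _

theorem star_translation (g : Γ) : star (translation H g) = translation H g⁻¹ := by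
  rw [translation, translation, twistedTranslation_inv]
  simp [TwoCocycle.trivial]

theorem ampl_mul (S T : H →L[ℂ] H) : ampl Γ (S * T) = ampl Γ S * ampl Γ T :=
  map_mul (amplHom Γ H) S T

theorem star_ampl (T : H →L[ℂ] H) : star (ampl Γ T) = ampl Γ (star T) :=
  (map_star (amplHom Γ H) T).symm

theorem ampl_mul_translation (g : Γ) (T : H →L[ℂ] H) :
    ampl Γ T * translation H g = translation H g * ampl Γ T := by
  ext f s
  simp [translation, TwoCocycle.trivial]

/-- The operator `λ_g ⊗ T`. -/
noncomputable def lamTensor (g : Γ) (T : H →L[ℂ] H) : L2 Γ H →L[ℂ] L2 Γ H :=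
  translation H g * ampl Γ T

theorem lamTensor_mul (g h : Γ) (S T : H →L[ℂ] H) :
    lamTensor g S * lamTensor h T = lamTensor (g * h) (S * T) := by
  rw [lamTensor, lamTensor, lamTensor, mul_assoc, ← mul_assoc (ampl Γ S), ampl_mul_translation,
    ampl_mul, ← translation_mul]
  simp only [mul_assoc]

theorem star_lamTensor (g : Γ) (T : H →L[ℂ] H) :
    star (lamTensor g T) = lamTensor g⁻¹ (star T) := by
  rw [lamTensor, lamTensor, star_mul, star_translation, star_ampl, ampl_mul_translation]

theorem entry_lamTensor [DecidableEq Γ] (g : Γ) (T : H →L[ℂ] H) (s t : Γ) :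
    entry (lamTensor g T) s t = if s = g * t then T else 0 :=
  entry_translation_mul g T s t

theorem mem_closedSpan_of_mem_minTensor {π : A →⋆ₙₐ[ℂ] (H →L[ℂ] H)} {T : L2 Γ H →L[ℂ] L2 Γ H}
    (hT : T ∈ minTensor Γ π) : T ∈ closedSpan {T | ∃ (g : Γ) (a : A), T = lamTensor g (π a)} := by
  refine topologicalClosure_adjoin_le ?_ ?_ ?_ hT
  · rintro _ ⟨c, hc, a, rfl⟩
    refine mul_right_mem_closedSpan _ ?_ (mem_closedSpan_of_mem_twistedGroupAlgebra hc)
    rintro _ ⟨g, rfl⟩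
    exact subset_closedSpan ⟨g, a, rfl⟩
  · rintro _ ⟨g, a, rfl⟩ _ ⟨h, b, rfl⟩
    exact subset_closedSpan ⟨g * h, a * b, by rw [lamTensor_mul, map_mul]⟩
  · rintro _ ⟨g, a, rfl⟩
    exact subset_closedSpan ⟨g⁻¹, star a, by rw [star_lamTensor, map_star]⟩

theorem ampl_mem_minTensor (π : A →⋆ₙₐ[ℂ] (H →L[ℂ] H)) (a : A) : ampl Γ (π a) ∈ minTensor Γ π :=
  NonUnitalStarSubalgebra.le_topologicalClosure _ (NonUnitalStarAlgebra.subset_adjoin ℂ _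
    ⟨1, translation_one (H := H) (Γ := Γ) ▸ twistedTranslation_mem _ _, a, (one_mul _).symm⟩)

theorem hasColumnSum_of_mem_minTensor {π : A →⋆ₙₐ[ℂ] (H →L[ℂ] H)} {T : L2 Γ H →L[ℂ] L2 Γ H}
    (hT : T ∈ minTensor Γ π) (t : Γ) : HasColumnSum T t := by
  classical
  refine hasColumnSum_of_mem_closedSpan ?_ (mem_closedSpan_of_mem_minTensor hT)
  rintro _ ⟨g, a, rfl⟩
  unfold HasColumnSum
  convert hasSum_single (g * t) ?_ using 1
  · ext v : 1
    ext s
    change entry (lamTensor g (π a)) s t v = _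
    rw [entry_lamTensor, entry_lamTensor, if_pos rfl]
    split_ifs with h <;> simp [h]
  · intro s hs
    rw [entry_lamTensor, if_neg hs]
    simp

/-- An injective `π` is isometric, so its range is closed and it suffices to slice the `λ_g ⊗ π a`.
-/
theorem exists_entry_eq {π : A →⋆ₙₐ[ℂ] (H →L[ℂ] H)} (hπ : IsFaithfulNondegenerate π)
    {T : L2 Γ H →L[ℂ] L2 Γ H} (hT : T ∈ minTensor Γ π) (s t : Γ) : ∃ a, π a = entry T s t := by
  classical
  have hW : IsClosed (LinearMap.range π.toCLM.toLinearMap : Set (H →L[ℂ] H)) :=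
    (NonUnitalStarAlgHom.isometry π hπ.injective).isClosedEmbedding.isClosed_range
  refine mem_of_mem_closedSpan hW (entryL s t) ?_ (mem_closedSpan_of_mem_minTensor hT)
  rintro _ ⟨g, a, rfl⟩
  rw [entryL_apply, entry_lamTensor]
  split_ifs
  · exact ⟨a, rfl⟩
  · exact zero_mem _

variable (Γ H) in
/-- The map `T ↦ λ_g ⊗ T` as a continuous linear map. -/
noncomputable def lamTensorL (g : Γ) : (H →L[ℂ] H) →L[ℂ] (L2 Γ H →L[ℂ] L2 Γ H) :=
  (ContinuousLinearMap.mul ℂ _ (translation H g)).comp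
    (amplHom Γ H).toCLM

theorem lamTensorL_apply (g : Γ) (T : H →L[ℂ] H) : lamTensorL Γ H g T = lamTensor g T := rfl

/-- By linearity and continuity take `T = λ_g ⊗ π a`, with `(δ ⊗ ι)(T) = λ_g ⊗ λ_g ⊗ π a`. Column
`1` has its only entry in row `g`, so the slice at `(s, 1)` isolates the part of degree `s`. -/
theorem entry_comult {π : A →⋆ₙₐ[ℂ] (H →L[ℂ] H)} {T : L2 Γ H →L[ℂ] L2 Γ H}
    (hT : T ∈ minTensor Γ π) (s : Γ) :
    entry (unflatten (comult T)) s 1 = lamTensor s (entry T s 1) := by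
  classical
  have h := eq_of_mem_closedSpan ((entryL s 1).comp (comultHom Γ H).toCLM)
    ((lamTensorL Γ H s).comp (entryL s 1)) ?_ (mem_closedSpan_of_mem_minTensor hT)
  · simpa only [ContinuousLinearMap.comp_apply, StarAlgHom.toCLM_apply, comultHom_apply,
      entryL_apply, lamTensorL_apply] using h
  rintro _ ⟨g, a, rfl⟩
  simp only [ContinuousLinearMap.comp_apply, StarAlgHom.toCLM_apply, comultHom_apply,
      entryL_apply, lamTensorL_apply]
  rw [lamTensor, comult_translation_mul, entry_translation_mul, ← lamTensor,
    entry_lamTensor, mul_one]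
  split_ifs with h
  · rw [h]
  · exact (map_zero (lamTensorL Γ H s)).symm

theorem entry_translation_mul_left (g : Γ) (T : L2 Γ H →L[ℂ] L2 Γ H) (s t : Γ) :
    entry (translation H g * T) s t = entry T (g⁻¹ * s) t := by
  ext v
  simp [entry_apply, translation, TwoCocycle.trivial]

theorem entry_ampl_mul {K : Type*} [NormedAddCommGroup K] [InnerProductSpace ℂ K]
    [CompleteSpace K] (X : K →L[ℂ] K) (T : L2 Γ K →L[ℂ] L2 Γ K) (s t : Γ) :
    entry (ampl Γ X * T) s t = X * entry T s t := by
  ext v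
  simp [entry_apply]

end Translations

end Coact

namespace Coact

/-! ### Homogeneous elements for `a ↦ X α(a)` and their density. -/

section Spectral

variable {Γ : Type*} [Group Γ] {H : Type*} [NormedAddCommGroup H] [InnerProductSpace ℂ H]
  [CompleteSpace H] {A : Type*} [NonUnitalCStarAlgebra A]
  {π : A →⋆ₙₐ[ℂ] (H →L[ℂ] H)} {α β : A →⋆ₙₐ[ℂ] (L2 Γ H →L[ℂ] L2 Γ H)} {X : L2 Γ H →L[ℂ] L2 Γ H}

/-- The homogeneous elements for the coaction `a ↦ X α(a)` on the right Hilbert module `A`. -/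
def spectralSet (π : A →⋆ₙₐ[ℂ] (H →L[ℂ] H)) (α : A →⋆ₙₐ[ℂ] (L2 Γ H →L[ℂ] L2 Γ H))
    (X : L2 Γ H →L[ℂ] L2 Γ H) : Set A :=
  {b | ∃ g, X * α b = lamTensor g (π b)}

theorem comult_mul (S T : L2 Γ H →L[ℂ] L2 Γ H) : comult (S * T) = comult S * comult T := by
  apply unflatten_injective
  rw [unflatten_mul]
  exact map_mul (comultHom Γ H) S T

/-- Compare the slices at `(s, 1)` of the two sides of `(δ ⊗ ι)(X α(a)) = X₂₃ (ι ⊗ α)(X α(a))`: the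
left one is `λ_s ⊗ π b` and the right one is `X α(b)`, where `b` is the slice of `X α(a)`. -/
theorem IsCoactionCocycle.exists_slice_mem_spectralSet (hX : IsCoactionCocycle π α X)
    (hπ : IsFaithfulNondegenerate π) (hα : IsCoaction π α) (a : A) (s : Γ) :
    ∃ b ∈ spectralSet π α X, π b = entry (X * α a) s 1 := by
  obtain ⟨Y, hY, hXY⟩ := hX.cocycle
  have hT : X * α a ∈ minTensor Γ π := (hX.multiplier _ (hα.mem a)).1
  obtain ⟨b, hb⟩ := exists_entry_eq hπ hT s 1
  choose c hc hc' using hα.coassoc a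
  choose d hd hd' using hY
  have h1 : HasSum (fun r => π (d s r (c r 1))) (π b) := by
    have := (hasColumnSum_of_mem_minTensor (hα.mem a) 1).hasSum_entry_mul X s
    rw [hb]
    simpa only [hd, hc] using this
  -- Since `π` is isometric, the norm convergent series descends to `A`, where `α` can be applied to
  -- it.
  have h2 : HasSum (fun r => d s r (c r 1)) b :=
    ((NonUnitalStarAlgHom.isometry π hπ.injective).isUniformInducing.isInducing.hasSum_iff
      (g := π) _ _).1 h1
  have h3 := h2.mapL α.toCLM
  -- The product `Y (δ ⊗ ι)(α(a))` plays the role of `(ι ⊗ α)(X α(a))`. Its entry is a strongly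
  -- convergent series with the terms of `h3`, so the limits agree on each vector.
  have h4 : entry (unflatten Y * unflatten (comult (α a))) s 1 = α b := by
    ext1 v
    refine (hasSum_entry_mul_apply _ _ s 1 v).unique ?_
    have := h3.mapL (ContinuousLinearMap.apply ℂ (L2 Γ H) v)
    simpa only [NonUnitalStarAlgHom.toCLM_apply, hd', hc', ContinuousLinearMap.apply_apply,
      mul_apply_eq_comp] using this
  refine ⟨b, ⟨s, ?_⟩, hb⟩
  rw [hb, ← entry_comult hT, comult_mul, ← hXY, mul_assoc, unflatten_mul, unflatten_mul,
    unflatten_amplL, entry_ampl_mul, h4]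

theorem IsExteriorEquivalence.mul_eq (hX : IsExteriorEquivalence π α β X) (a : A) :
    X * α a = β a * X := by
  rw [← hX.conj a, mul_assoc, Unitary.star_mul_self_of_mem hX.isCocycle.unitary, mul_one]

/-- By cancellation for `β`, `(1 ⊗ a) X*` is a limit of sums of `(c ⊗ 1) β(a')`. Multiplying by `X`
on the right turns these into `(c ⊗ 1) X α(a')`; the slice at `(1, 1)` then recovers `a` on one side
and homogeneous elements on the other. -/
theorem IsExteriorEquivalence.mem_closedSpan_spectralSet (hX : IsExteriorEquivalence π α β X)
    (hπ : IsFaithfulNondegenerate π) (hα : IsCoaction π α) (hβ : IsCoaction π β) (a : A) :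
    a ∈ closedSpan (spectralSet π α X) := by
  have h1 : ampl Γ (π a) * star X ∈ minTensor Γ π := by
    have := (hX.isCocycle.multiplier _ (star_mem (ampl_mem_minTensor (Γ := Γ) π a))).1
    simpa using star_mem this
  have h2 : ampl Γ (π a) * star X ∈
      closedSpan {T | ∃ c ∈ reducedGroupAlgebra Γ H, ∃ a, T = c * β a} := by
    rw [← SetLike.mem_coe, coe_closedSpan, hβ.cancellation]
    exact h1
  refine mem_closedSpan_of_isometry π.toCLM (NonUnitalStarAlgHom.isometry π hπ.injective) ?_
  have h3 : entry (ampl Γ (π a)) (1 : Γ) 1 = π a := by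
    have := entry_ampl_mul (π a) (1 : L2 Γ H →L[ℂ] L2 Γ H) 1 1
    have h' : entry (1 : L2 Γ H →L[ℂ] L2 Γ H) 1 1 = 1 := by
      ext v
      simp [entry_apply]
    rwa [mul_one, h', mul_one] at this
  have h4 := map_mem_closedSpan (t := π.toCLM '' spectralSet π α X)
    ((entryL (1 : Γ) 1).comp ((ContinuousLinearMap.mul ℂ (L2 Γ H →L[ℂ] L2 Γ H)).flip X)) ?_ h2
  · simp only [ContinuousLinearMap.comp_apply, ContinuousLinearMap.flip_apply,
      ContinuousLinearMap.mul_apply', entryL_apply] at h4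
    rw [mul_assoc, Unitary.star_mul_self_of_mem hX.isCocycle.unitary, mul_one, h3] at h4
    exact h4
  rintro _ ⟨c, hc, a', rfl⟩
  have h5 := map_mem_closedSpan (t := π.toCLM '' spectralSet π α X)
    ((entryL (1 : Γ) 1).comp ((ContinuousLinearMap.mul ℂ (L2 Γ H →L[ℂ] L2 Γ H)).flip (X * α a'))) ?_
    (mem_closedSpan_of_mem_twistedGroupAlgebra hc)
  · simpa only [ContinuousLinearMap.comp_apply, ContinuousLinearMap.flip_apply,
      ContinuousLinearMap.mul_apply', entryL_apply, hX.mul_eq, mul_assoc] using h5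
  rintro _ ⟨g, rfl⟩
  -- Left multiplication by `λ_g` shifts rows, so the slice at `(1, 1)` becomes the slice of `X
  -- α(a')` at `(g⁻¹, 1)`.
  obtain ⟨b, hb, hb'⟩ := hX.isCocycle.exists_slice_mem_spectralSet hπ hα a' (g⁻¹ * 1)
  refine subset_closedSpan ⟨b, hb, ?_⟩
  simp only [ContinuousLinearMap.comp_apply, ContinuousLinearMap.flip_apply,
      ContinuousLinearMap.mul_apply', entryL_apply, NonUnitalStarAlgHom.toCLM_apply]
  rw [hb']
  exact (entry_translation_mul_left g _ _ _).symm

/-- `X` is a unitary that intertwines `α` and `β`, and the homogeneous elements for `a ↦ X α(a)`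
span a dense subspace of `A`. -/
structure IsGradedTwist (π : A →⋆ₙₐ[ℂ] (H →L[ℂ] H)) (α β : A →⋆ₙₐ[ℂ] (L2 Γ H →L[ℂ] L2 Γ H))
    (X : L2 Γ H →L[ℂ] L2 Γ H) : Prop where
  star_mul_self : star X * X = 1
  mul_star_self : X * star X = 1
  mul_eq : ∀ a, X * α a = β a * X
  dense : ∀ a, a ∈ closedSpan (spectralSet π α X)

theorem IsExteriorEquivalence.isGradedTwist (hX : IsExteriorEquivalence π α β X)
    (hπ : IsFaithfulNondegenerate π) (hα : IsCoaction π α) (hβ : IsCoaction π β) :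
    IsGradedTwist π α β X :=
  ⟨Unitary.star_mul_self_of_mem hX.isCocycle.unitary,
    Unitary.mul_star_self_of_mem hX.isCocycle.unitary, hX.mul_eq,
    hX.mem_closedSpan_spectralSet hπ hα hβ⟩

namespace IsGradedTwist

theorem star_mul_eq (h : IsGradedTwist π α β X) (a : A) : star X * β a = α a * star X := by
  have := congrArg star (h.mul_eq (star a))
  simpa only [star_mul, map_star, star_star] using this.symm

theorem star (h : IsGradedTwist π α β X) : IsGradedTwist π β α (star X) where
  star_mul_self := by rw [star_star, h.mul_star_self]
  mul_star_self := by rw [star_star, h.star_mul_self]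
  mul_eq := h.star_mul_eq
  dense a := by
    rw [← star_star a]
    refine star_mem_closedSpan (fun b hb => subset_closedSpan ?_) (h.dense (Star.star a))
    obtain ⟨g, hg⟩ := hb
    refine ⟨g⁻¹, ?_⟩
    rw [h.star_mul_eq, map_star, map_star, ← star_mul, hg, star_lamTensor]

/-- The unitary cancels in `(X α(b))* (X α(c))`: quotients of twisted homogeneous elements are
homogeneous for `α` itself. -/
theorem apply_star_mul (h : IsGradedTwist π α β X) {b c : A} {g k : Γ}
    (hb : X * α b = lamTensor g (π b)) (hc : X * α c = lamTensor k (π c)) :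
    α (Star.star b * c) = lamTensor (g⁻¹ * k) (π (Star.star b * c)) := by
  have : α (Star.star b * c) = Star.star (X * α b) * (X * α c) := by
    rw [star_mul, mul_assoc, ← mul_assoc (Star.star X), h.star_mul_self, one_mul, map_mul, map_star]
  rw [this, hb, hc, star_lamTensor, lamTensor_mul, map_mul, map_star]

theorem trivial (h : IsGradedTwist π α β X) : IsGradedTwist π α α 1 where
  star_mul_self := by simp
  mul_star_self := by simp
  mul_eq a := by simp
  dense a := by
    refine closedSpan_le (isClosed_closedSpan _) ?_ (mem_closedSpan_star_mul h.dense a)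
    rintro _ ⟨b, ⟨g, hb⟩, c, ⟨k, hc⟩, rfl⟩
    refine subset_closedSpan ⟨g⁻¹ * k, ?_⟩
    rw [one_mul, h.apply_star_mul hb hc]

end IsGradedTwist

end Spectral

end Coact

namespace Coact

/-! ### Commutation relations in the braided tensor product. -/

section Braided

variable {Γ : Type*} [Group Γ] {H : Type*} [NormedAddCommGroup H] [InnerProductSpace ℂ H]
  [CompleteSpace H] {A : Type*} [NonUnitalCStarAlgebra A]
  {π : A →⋆ₙₐ[ℂ] (H →L[ℂ] H)} {α β : A →⋆ₙₐ[ℂ] (L2 Γ H →L[ℂ] L2 Γ H)} {X : L2 Γ H →L[ℂ] L2 Γ H}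

theorem amplR_mul (S T : L2 Γ H →L[ℂ] L2 Γ H) : amplR Γ (S * T) = amplR Γ S * amplR Γ T :=
  map_mul (amplRHom Γ Γ H) S T

theorem star_amplR (T : L2 Γ H →L[ℂ] L2 Γ H) : star (amplR Γ T) = amplR Γ (star T) :=
  (map_star (amplRHom Γ Γ H) T).symm

theorem amplR_one : amplR Γ (1 : L2 Γ H →L[ℂ] L2 Γ H) = 1 := map_one (amplRHom Γ Γ H)

variable (H) in
/-- The operator `adTilde(λ^(ω)_k)₁₃`. -/
noncomputable def adTranslation (ω : TwoCocycle Γ) (k : Γ) :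
    L2 (Γ × Γ) H →L[ℂ] L2 (Γ × Γ) H :=
  adTilde ω (twistedTranslation H ω k)

theorem adTranslation_mul (ω : TwoCocycle Γ) (g h : Γ) :
    adTranslation H ω g * adTranslation H ω h =
      (ω.toFun g h : ℂ) • adTranslation H ω (g * h) := by
  simp only [adTranslation, ← adTildeHom_apply]
  rw [← map_mul, twistedTranslation_mul, map_smul]

theorem adTranslation_one (ω : TwoCocycle Γ) : adTranslation H ω 1 = 1 := by
  rw [adTranslation, twistedTranslation_one, ← adTildeHom_apply, map_one]

theorem star_adTranslation_mul_self (ω : TwoCocycle Γ) (g : Γ) :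
    star (adTranslation H ω g) * adTranslation H ω g = 1 := by
  rw [adTranslation, ← adTildeHom_apply, ← map_star, ← map_mul, star_mul_twistedTranslation,
    map_one]

theorem exists_star_adTranslation (ω : TwoCocycle Γ) (g : Γ) :
    ∃ c : ℂ, star (adTranslation H ω g) = c • adTranslation H ω g⁻¹ := by
  obtain ⟨c, hc⟩ := exists_star_twistedTranslation (H := H) ω g
  refine ⟨c, ?_⟩
  simp only [adTranslation, ← adTildeHom_apply]
  rw [← map_star, hc, map_smul]

theorem ampl_mul_twistedTranslation (ω : TwoCocycle Γ) (g : Γ) (T : H →L[ℂ] H) :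
    ampl Γ T * twistedTranslation H ω g = twistedTranslation H ω g * ampl Γ T := by
  ext f s
  simp

theorem twistedTranslation_mul_conj (ω : TwoCocycle Γ) (h g : Γ) (x : L2 Γ H →L[ℂ] L2 Γ H) :
    twistedTranslation H ω (h * g) * (star (twistedTranslation H ω g) * x *
      twistedTranslation H ω g) * star (twistedTranslation H ω (h * g)) =
    twistedTranslation H ω h * x * star (twistedTranslation H ω h) := by
  have h1 : twistedTranslation H ω (h * g) =
      ((ω.toFun h g)⁻¹ : ℂ) • (twistedTranslation H ω h * twistedTranslation H ω g) := by
    rw [twistedTranslation_mul, smul_smul]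
    simp
  have h2 : twistedTranslation H ω (h * g) * star (twistedTranslation H ω g) =
      ((ω.toFun h g)⁻¹ : ℂ) • twistedTranslation H ω h := by
    rw [h1, smul_mul_assoc, mul_assoc, twistedTranslation_mul_star, mul_one]
  have h3 : twistedTranslation H ω g * star (twistedTranslation H ω (h * g)) =
      star (((ω.toFun h g)⁻¹ : ℂ) • twistedTranslation H ω h) := by
    rw [← h2, star_mul, star_star]
  calc _ = (twistedTranslation H ω (h * g) * star (twistedTranslation H ω g)) * x *
        (twistedTranslation H ω g * star (twistedTranslation H ω (h * g))) := by
        simp only [mul_assoc]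
    _ = _ := by
        rw [h3, h2, star_smul, smul_mul_assoc, smul_mul_assoc, mul_smul_comm, smul_smul]
        simp [← mul_inv, Complex.mul_conj]

theorem curry_amplR_lamTensor (g : Γ) (T : H →L[ℂ] H) (f : L2 (Γ × Γ) H) (h : Γ) :
    curry (amplR Γ (lamTensor g T) f) h = ampl Γ T (curry f (g⁻¹ * h)) := by
  ext k
  simp [amplR_apply, lamTensor, translation, TwoCocycle.trivial]

/-- At the component `h`, `λ_g` moves the index to `g⁻¹ h`, where `adTilde` acts by `Ad_{h⁻¹ g}`.
Conjugating `x` by `λ_g*` compensates for this, leaving `Ad_{h⁻¹}(x)` on both sides. -/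
theorem adTilde_mul_amplR (ω : TwoCocycle Γ) (x : L2 Γ H →L[ℂ] L2 Γ H) (g : Γ) (T : H →L[ℂ] H)
    (hx : ampl Γ T * x = x * ampl Γ T) :
    adTilde ω x * amplR Γ (lamTensor g T) = amplR Γ (lamTensor g T) *
      adTilde ω (star (twistedTranslation H ω g) * x * twistedTranslation H ω g) := by
  ext1 f
  refine curry.injective (lp.ext (funext fun h => ?_))
  rw [mul_apply_eq_comp, mul_apply_eq_comp, adTilde_apply, curry_amplR_lamTensor,
    curry_amplR_lamTensor, adTilde_apply, mul_inv_rev, inv_inv, twistedTranslation_mul_conj,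
    ← mul_apply_eq_comp, ← mul_apply_eq_comp]
  congr 1
  have h1 := ampl_mul_twistedTranslation ω h⁻¹ T
  have h2 : ampl Γ T * star (twistedTranslation H ω h⁻¹) =
      star (twistedTranslation H ω h⁻¹) * ampl Γ T := by
    have := congrArg star (ampl_mul_twistedTranslation ω h⁻¹ (star T))
    simpa only [star_mul, star_ampl, star_star] using this.symm
  rw [mul_assoc, mul_assoc, ← h2, ← mul_assoc x, ← hx, mul_assoc, ← mul_assoc _ (ampl Γ T), ← h1]
  simp only [mul_assoc]

/-- `adTilde(λ^(ω)_k)₁₃` commutes with `(λ_g ⊗ T)₁₂` up to conjugating `k` and a phase. -/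
theorem exists_adTranslation_mul_amplR (ω : TwoCocycle Γ) (k g : Γ) : ∃ (c : ℂ) (k' : Γ),
    ∀ T : H →L[ℂ] H, adTranslation H ω k * amplR Γ (lamTensor g T) =
      c • (amplR Γ (lamTensor g T) * adTranslation H ω k') := by
  obtain ⟨c, hc⟩ := exists_star_twistedTranslation (H := H) ω g
  refine ⟨c * ω.toFun g⁻¹ k * ω.toFun (g⁻¹ * k) g, g⁻¹ * k * g, fun T => ?_⟩
  rw [adTranslation, adTilde_mul_amplR ω _ _ _ (ampl_mul_twistedTranslation ω k T), hc,
    smul_mul_assoc, smul_mul_assoc, twistedTranslation_mul, smul_mul_assoc, twistedTranslation_mul,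
    smul_smul, smul_smul, adTranslation, ← adTildeHom_apply, map_smul, mul_smul_comm,
    adTildeHom_apply]

/-- The elements `α(a)₁₂ adTilde(λ^(ω)_k)₁₃`. -/
def braidedGenerators (α : A →⋆ₙₐ[ℂ] (L2 Γ H →L[ℂ] L2 Γ H)) (ω : TwoCocycle Γ) :
    Set (L2 (Γ × Γ) H →L[ℂ] L2 (Γ × Γ) H) :=
  {T | ∃ a k, T = amplR Γ (α a) * adTranslation H ω k}

/-- `a ↦ S α(a)₁₂ T` as a continuous linear map. -/
noncomputable def sandwich (α : A →⋆ₙₐ[ℂ] (L2 Γ H →L[ℂ] L2 Γ H))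
    (S T : L2 (Γ × Γ) H →L[ℂ] L2 (Γ × Γ) H) : A →L[ℂ] (L2 (Γ × Γ) H →L[ℂ] L2 (Γ × Γ) H) :=
  ((ContinuousLinearMap.mul ℂ _).flip T).comp
    ((ContinuousLinearMap.mul ℂ _ S).comp ((amplRHom Γ Γ H).toCLM.comp α.toCLM))

theorem sandwich_apply (S T : L2 (Γ × Γ) H →L[ℂ] L2 (Γ × Γ) H) (a : A) :
    sandwich α S T a = S * amplR Γ (α a) * T := rfl

theorem mul_adTranslation_mem {ω : TwoCocycle Γ} {T : L2 (Γ × Γ) H →L[ℂ] L2 (Γ × Γ) H}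
    (hT : T ∈ closedSpan (braidedGenerators α ω)) (k : Γ) :
    T * adTranslation H ω k ∈ closedSpan (braidedGenerators α ω) := by
  refine mul_right_mem_closedSpan _ ?_ hT
  rintro _ ⟨a, l, rfl⟩
  rw [mul_assoc, adTranslation_mul, mul_smul_comm]
  exact Submodule.smul_mem _ _ (subset_closedSpan ⟨a, _, rfl⟩)

namespace IsGradedTwist

/-- The unitary `X₁₂* adTilde(λ^(ω)_k)₁₃ X₁₂` multiplies `α(A)₁₂` into the braided tensor
product. -/
theorem conj_adTranslation_mul_mem (h : IsGradedTwist π α β X) (ω : TwoCocycle Γ) (k : Γ) (a : A) :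
    Star.star (amplR Γ X) * adTranslation H ω k * amplR Γ X * amplR Γ (α a) ∈
      closedSpan (braidedGenerators α ω) := by
  have := map_mem_closedSpan (t := braidedGenerators α ω)
    (sandwich α (Star.star (amplR Γ X) * adTranslation H ω k * amplR Γ X) 1) ?_ (h.dense a)
  · simpa only [sandwich_apply, mul_one] using this
  rintro b ⟨g, hb⟩
  obtain ⟨c, k', hc⟩ := exists_adTranslation_mul_amplR (H := H) ω k g
  have h1 : Star.star (amplR Γ X) * amplR Γ X = 1 := by
    rw [star_amplR, ← amplR_mul, h.star_mul_self, amplR_one]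
  -- For homogeneous `b`, `X₁₂ α(b)₁₂` is `(λ_g ⊗ π b)₁₂`, which can be moved to the left of
  -- `adTilde(λ_k)₁₃`; read backwards it gives `X₁₂ α(b)₁₂`, and `X₁₂*` cancels.
  rw [sandwich_apply, mul_one, mul_assoc, ← amplR_mul, hb, mul_assoc, hc, ← hb, amplR_mul,
    mul_smul_comm, ← mul_assoc, ← mul_assoc, h1, one_mul]
  exact Submodule.smul_mem _ _ (subset_closedSpan ⟨b, k', rfl⟩)

theorem adTranslation_mul_amplR_mem (h : IsGradedTwist π α β X) (ω : TwoCocycle Γ) (k : Γ)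
    (a : A) : adTranslation H ω k * amplR Γ (α a) ∈ closedSpan (braidedGenerators α ω) := by
  have := h.trivial.conj_adTranslation_mul_mem ω k a
  simpa only [amplR_one, star_one, one_mul, mul_one] using this

/-- Reordering `adTilde(λ_k)₁₃ α(b)₁₂` within the closed span makes that span a `*`-algebra. The
twist `X` serves only to supply density of the homogeneous elements for `α`. -/
theorem mem_braidedTensor_iff (h : IsGradedTwist π α β X) (ω : TwoCocycle Γ)
    {T : L2 (Γ × Γ) H →L[ℂ] L2 (Γ × Γ) H} :
    T ∈ braidedTensor α ω ↔ T ∈ closedSpan (braidedGenerators α ω) := by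
  constructor
  · refine topologicalClosure_adjoin_le ?_ ?_ ?_
    · rintro _ ⟨a, x, hx, rfl⟩
      refine map_mem_closedSpan ((ContinuousLinearMap.mul ℂ _ (amplR Γ (α a))).comp
        (adTildeHom H ω).toCLM) ?_ (mem_closedSpan_of_mem_twistedGroupAlgebra hx)
      rintro _ ⟨k, rfl⟩
      exact subset_closedSpan ⟨a, k, rfl⟩
    · rintro _ ⟨a, k, rfl⟩ _ ⟨b, l, rfl⟩
      rw [mul_assoc, ← mul_assoc (adTranslation H ω k)]
      refine mul_left_mem_closedSpan _ ?_
        (mul_adTranslation_mem (h.adTranslation_mul_amplR_mem ω k b) l)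
      rintro _ ⟨c, m, rfl⟩
      rw [← mul_assoc, ← amplR_mul, ← map_mul]
      exact subset_closedSpan ⟨a * c, m, rfl⟩
    · rintro _ ⟨a, k, rfl⟩
      obtain ⟨c, hc⟩ := exists_star_adTranslation (H := H) ω k
      rw [star_mul, hc, star_amplR, ← map_star, smul_mul_assoc]
      exact Submodule.smul_mem _ _ (h.adTranslation_mul_amplR_mem ω _ _)
  · refine fun hT => closedSpan_le (W := (braidedTensor α ω).toSubmodule)
      (NonUnitalStarSubalgebra.isClosed_topologicalClosure _) ?_ hT
    rintro _ ⟨a, k, rfl⟩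
    exact NonUnitalStarSubalgebra.le_topologicalClosure _ (NonUnitalStarAlgebra.subset_adjoin ℂ _
      ⟨a, _, twistedTranslation_mem ω k, rfl⟩)

theorem conj_adTranslation_mul_mem_braidedTensor (h : IsGradedTwist π α β X) (ω : TwoCocycle Γ)
    (k l : Γ) (a : A) :
    Star.star (amplR Γ X) * adTranslation H ω k * amplR Γ X * amplR Γ (α a) *
      adTranslation H ω l ∈ braidedTensor α ω :=
  (h.mem_braidedTensor_iff ω).2 (mul_adTranslation_mem (h.conj_adTranslation_mul_mem ω k a) l)

/-- On generators, `X₁₂* β(a)₁₂ V X₁₂ = α(a)₁₂ X₁₂* V X₁₂`, the adjoint of an element covered by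
`conj_adTranslation_mul_mem`. -/
theorem conj_mem_braidedTensor (h : IsGradedTwist π α β X) (ω : TwoCocycle Γ)
    {T : L2 (Γ × Γ) H →L[ℂ] L2 (Γ × Γ) H} (hT : T ∈ braidedTensor β ω) :
    Star.star (amplR Γ X) * T * amplR Γ X ∈ braidedTensor α ω := by
  rw [h.mem_braidedTensor_iff]
  refine map_mem_closedSpan (((ContinuousLinearMap.mul ℂ _).flip (amplR Γ X)).comp
    (ContinuousLinearMap.mul ℂ _ (Star.star (amplR Γ X)))) ?_
    ((h.star.mem_braidedTensor_iff ω).1 hT)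
  rintro _ ⟨a, k, rfl⟩
  obtain ⟨c, hc⟩ := exists_star_adTranslation (H := H) ω k
  rw [← h.mem_braidedTensor_iff]
  have h1 : Star.star (amplR Γ X) * Star.star (adTranslation H ω k) * amplR Γ X *
      amplR Γ (α (Star.star a)) ∈ braidedTensor α ω := by
    rw [hc, mul_smul_comm, smul_mul_assoc, smul_mul_assoc, h.mem_braidedTensor_iff]
    exact Submodule.smul_mem _ _ (h.conj_adTranslation_mul_mem ω _ _)
  convert star_mem h1 using 1
  change Star.star (amplR Γ X) * (amplR Γ (β a) * adTranslation H ω k) * amplR Γ X = _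
  simp only [star_mul, star_star, map_star, star_amplR, ← mul_assoc, ← amplR_mul, h.star_mul_eq]

end IsGradedTwist

/-! ### Degrees -/

/-- `T` is homogeneous of degree `g` for the diagonal coaction. -/
def HasDegree (g : Γ) (T : L2 (Γ × Γ) H →L[ℂ] L2 (Γ × Γ) H) : Prop :=
  diagHom Γ H T = lamTensor g T

theorem HasDegree.mul {g h : Γ} {S T : L2 (Γ × Γ) H →L[ℂ] L2 (Γ × Γ) H} (hS : HasDegree g S)
    (hT : HasDegree h T) : HasDegree (g * h) (S * T) := by
  rw [HasDegree, map_mul, hS, hT, lamTensor_mul]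

theorem HasDegree.star {g : Γ} {T : L2 (Γ × Γ) H →L[ℂ] L2 (Γ × Γ) H} (hT : HasDegree g T) :
    HasDegree g⁻¹ (star T) := by
  rw [HasDegree, map_star, hT, star_lamTensor]

theorem hasDegree_one_iff {T : L2 (Γ × Γ) H →L[ℂ] L2 (Γ × Γ) H} :
    HasDegree 1 T ↔ diagCoaction Γ H T = amplL Γ T := by
  rw [diagCoaction_eq_iff, HasDegree, lamTensor, translation_one, one_mul]

theorem hasDegree_adTranslation (ω : TwoCocycle Γ) (g : Γ) : HasDegree g (adTranslation H ω g) :=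
  diagCoaction_adTilde ω g

theorem hasDegree_amplR (g : Γ) (T : H →L[ℂ] H) : HasDegree g (amplR Γ (lamTensor g T)) := by
  rw [HasDegree, diagHom_apply, diagCoaction_amplR]
  ext f r p
  obtain ⟨s, t⟩ := p
  simp [unflatten, lamTensor, amplR_apply, comult, comultUnitary, amplL_apply, translation,
    TwoCocycle.trivial, mul_assoc]

variable (Γ H) in
/-- The conditional expectation onto the fixed points of the diagonal coaction. -/
noncomputable def diagExpectation : (L2 (Γ × Γ) H →L[ℂ] L2 (Γ × Γ) H) →L[ℂ]
    (L2 (Γ × Γ) H →L[ℂ] L2 (Γ × Γ) H) :=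
  (entryL (1 : Γ) 1).comp (diagHom Γ H).toCLM

theorem HasDegree.diagExpectation_eq [DecidableEq Γ] {g : Γ}
    {T : L2 (Γ × Γ) H →L[ℂ] L2 (Γ × Γ) H} (hT : HasDegree g T) :
    diagExpectation Γ H T = if 1 = g then T else 0 := by
  have : diagExpectation Γ H T = entry (diagHom Γ H T) 1 1 := rfl
  rw [this, hT, entry_lamTensor, mul_one]

end Braided

end Coact

namespace Coact

/-! ### The bimodule of a graded twist and fullness of its inner products. -/

section Bimodule

variable {Γ : Type*} [Group Γ] {H : Type*} [NormedAddCommGroup H] [InnerProductSpace ℂ H]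
  [CompleteSpace H] {A : Type*} [NonUnitalCStarAlgebra A]
  {π : A →⋆ₙₐ[ℂ] (H →L[ℂ] H)} {α β : A →⋆ₙₐ[ℂ] (L2 Γ H →L[ℂ] L2 Γ H)} {X : L2 Γ H →L[ℂ] L2 Γ H}
  {ω : TwoCocycle Γ}

theorem mem_cocycleBimodule_iff {x : L2 (Γ × Γ) H →L[ℂ] L2 (Γ × Γ) H} :
    x ∈ cocycleBimodule α ω X ↔
      (∃ y ∈ braidedTensor α ω.conj, x = y * star (amplR Γ X)) ∧ HasDegree 1 x := by
  rw [hasDegree_one_iff]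
  rfl

theorem mem_deformation_iff {x : L2 (Γ × Γ) H →L[ℂ] L2 (Γ × Γ) H} :
    x ∈ deformation α ω ↔ x ∈ braidedTensor α ω.conj ∧ HasDegree 1 x := by
  rw [hasDegree_one_iff]
  rfl

theorem HasDegree.one_mul {S T : L2 (Γ × Γ) H →L[ℂ] L2 (Γ × Γ) H} (hS : HasDegree (1 : Γ) S)
    (hT : HasDegree (1 : Γ) T) : HasDegree (1 : Γ) (S * T) := by
  simpa using hS.mul hT

theorem HasDegree.star_one {T : L2 (Γ × Γ) H →L[ℂ] L2 (Γ × Γ) H}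
    (hT : HasDegree (1 : Γ) T) : HasDegree (1 : Γ) (Star.star T) := by
  simpa using hT.star

namespace IsGradedTwist

theorem amplR_star_mul_self (h : IsGradedTwist π α β X) :
    Star.star (amplR Γ X) * amplR Γ X = 1 := by
  rw [star_amplR, ← amplR_mul, h.star_mul_self, amplR_one]

theorem amplR_mul_star_self (h : IsGradedTwist π α β X) :
    amplR Γ X * Star.star (amplR Γ X) = 1 := by
  rw [star_amplR, ← amplR_mul, h.mul_star_self, amplR_one]

theorem mem_cocycleBimodule_iff_mul_mem (h : IsGradedTwist π α β X)
    {x : L2 (Γ × Γ) H →L[ℂ] L2 (Γ × Γ) H} :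
    x ∈ cocycleBimodule α ω X ↔ x * amplR Γ X ∈ braidedTensor α ω.conj ∧ HasDegree 1 x := by
  rw [mem_cocycleBimodule_iff]
  refine and_congr_left fun _ => ⟨?_, fun hx => ⟨_, hx, ?_⟩⟩
  · rintro ⟨y, hy, rfl⟩
    rwa [mul_assoc, h.amplR_star_mul_self, mul_one]
  · rw [mul_assoc, h.amplR_mul_star_self, mul_one]

theorem mul_mem_cocycleBimodule (h : IsGradedTwist π α β X)
    {b x : L2 (Γ × Γ) H →L[ℂ] L2 (Γ × Γ) H} (hb : b ∈ deformation α ω)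
    (hx : x ∈ cocycleBimodule α ω X) : b * x ∈ cocycleBimodule α ω X := by
  rw [h.mem_cocycleBimodule_iff_mul_mem] at hx ⊢
  rw [mem_deformation_iff] at hb
  refine ⟨?_, hb.2.one_mul hx.2⟩
  rw [mul_assoc]
  exact mul_mem hb.1 hx.1

/-- If `x X₁₂*` lies in the algebra for `β`, conjugating its adjoint `X₁₂ x*` by `X₁₂*` gives `x*
X₁₂` in the algebra for `α`. Through this symmetry the statements about `β` follow from those about
`α`. -/
theorem star_mem_cocycleBimodule (h : IsGradedTwist π α β X)
    {x : L2 (Γ × Γ) H →L[ℂ] L2 (Γ × Γ) H} (hx : x ∈ cocycleBimodule β ω (Star.star X)) :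
    Star.star x ∈ cocycleBimodule α ω X := by
  rw [h.star.mem_cocycleBimodule_iff_mul_mem] at hx
  rw [h.mem_cocycleBimodule_iff_mul_mem]
  refine ⟨?_, hx.2.star_one⟩
  have := h.conj_mem_braidedTensor _ (star_mem hx.1)
  rwa [star_mul, star_amplR, star_amplR, star_star, ← mul_assoc, ← amplR_mul, h.star_mul_self,
    amplR_one, one_mul] at this

theorem star_mem_cocycleBimodule_star (h : IsGradedTwist π α β X)
    {x : L2 (Γ × Γ) H →L[ℂ] L2 (Γ × Γ) H} (hx : x ∈ cocycleBimodule α ω X) :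
    Star.star x ∈ cocycleBimodule β ω (Star.star X) :=
  h.star.star_mem_cocycleBimodule (by rwa [star_star])

theorem mem_mul_cocycleBimodule (h : IsGradedTwist π α β X)
    {c x : L2 (Γ × Γ) H →L[ℂ] L2 (Γ × Γ) H} (hc : c ∈ deformation β ω)
    (hx : x ∈ cocycleBimodule α ω X) : x * c ∈ cocycleBimodule α ω X := by
  have := h.star_mem_cocycleBimodule
    (h.star.mul_mem_cocycleBimodule (star_mem hc) (h.star_mem_cocycleBimodule_star hx))
  simpa using this

theorem mul_star_mem_deformation (h : IsGradedTwist π α β X)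
    {x y : L2 (Γ × Γ) H →L[ℂ] L2 (Γ × Γ) H} (hx : x ∈ cocycleBimodule α ω X)
    (hy : y ∈ cocycleBimodule α ω X) : x * Star.star y ∈ deformation α ω := by
  rw [h.mem_cocycleBimodule_iff_mul_mem] at hx hy
  refine mem_deformation_iff.2 ⟨?_, hx.2.one_mul hy.2.star_one⟩
  have := mul_mem hx.1 (star_mem hy.1)
  rwa [star_mul, mul_assoc, ← mul_assoc (amplR Γ X), h.amplR_mul_star_self, _root_.one_mul] at this

theorem star_mul_mem_deformation (h : IsGradedTwist π α β X)
    {x y : L2 (Γ × Γ) H →L[ℂ] L2 (Γ × Γ) H} (hx : x ∈ cocycleBimodule α ω X)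
    (hy : y ∈ cocycleBimodule α ω X) : Star.star x * y ∈ deformation β ω := by
  have := h.star.mul_star_mem_deformation (h.star_mem_cocycleBimodule_star hx)
    (h.star_mem_cocycleBimodule_star hy)
  rwa [star_star] at this

theorem isClosed_cocycleBimodule (h : IsGradedTwist π α β X) :
    IsClosed (cocycleBimodule α ω X : Set (L2 (Γ × Γ) H →L[ℂ] L2 (Γ × Γ) H)) := by
  have : (cocycleBimodule α ω X : Set (L2 (Γ × Γ) H →L[ℂ] L2 (Γ × Γ) H)) =
      (fun x => x * amplR Γ X) ⁻¹' (braidedTensor α ω.conj) ∩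
        {x | diagCoaction Γ H x = amplLHom (Γ × Γ) Γ H x} := by
    ext x
    rw [SetLike.mem_coe, h.mem_cocycleBimodule_iff_mul_mem, hasDegree_one_iff]
    rfl
  rw [this]
  refine (IsClosed.preimage (by fun_prop)
    (NonUnitalStarSubalgebra.isClosed_topologicalClosure _)).inter ?_
  exact isClosed_eq (map_continuous (diagCoaction Γ H)) (map_continuous (amplLHom (Γ × Γ) Γ H))

/-- The elements `(adTilde(λ^(ω)_k)₁₃ X₁₂ α(b)₁₂ adTilde(λ^(ω)_l)₁₃)*` of degree `1` belong to the
bimodule of `X`. -/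
theorem star_mem_cocycleBimodule_of_hasDegree (h : IsGradedTwist π α β X) (k l : Γ) (b : A)
    (hdeg : HasDegree 1 (adTranslation H ω.conj k * (amplR Γ X * amplR Γ (α b)) *
      adTranslation H ω.conj l)) :
    Star.star (adTranslation H ω.conj k * (amplR Γ X * amplR Γ (α b)) *
      adTranslation H ω.conj l) ∈ cocycleBimodule α ω X := by
  rw [h.mem_cocycleBimodule_iff_mul_mem]
  refine ⟨?_, hdeg.star_one⟩
  have := star_mem (h.conj_adTranslation_mul_mem_braidedTensor ω.conj k l b)
  rw [← star_star (amplR Γ X), ← star_mul, star_star]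
  simpa only [mul_assoc] using this

theorem mem_closedSpan_mul_star (h : IsGradedTwist π α β X)
    {T : L2 (Γ × Γ) H →L[ℂ] L2 (Γ × Γ) H} (hT : T ∈ deformation α ω) :
    T ∈ closedSpan {z | ∃ x ∈ cocycleBimodule α ω X, ∃ y ∈ cocycleBimodule α ω X,
      z = x * Star.star y} := by
  classical
  rw [mem_deformation_iff, h.mem_braidedTensor_iff] at hT
  -- Generators need not be fixed points; as the expectation fixes `T`, it is enough to treat their
  -- expectations.
  have hE : diagExpectation Γ H T = T := by rw [hT.2.diagExpectation_eq, if_pos rfl]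
  rw [← hE]
  refine map_mem_closedSpan (diagExpectation Γ H) ?_ hT.1
  rintro _ ⟨a, k, rfl⟩
  have := map_mem_closedSpan ((diagExpectation Γ H).comp (sandwich α 1 (adTranslation H ω.conj k)))
    (t := {z | ∃ x ∈ cocycleBimodule α ω X, ∃ y ∈ cocycleBimodule α ω X, z = x * Star.star y})
    ?_ (mem_closedSpan_star_mul h.dense a)
  · simpa only [ContinuousLinearMap.comp_apply, sandwich_apply, _root_.one_mul] using this
  rintro _ ⟨c, ⟨m, hc⟩, b, ⟨n, hb⟩, rfl⟩
  have hdeg {a : A} {g : Γ} (ha : X * α a = lamTensor g (π a)) (k l : Γ) :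
      HasDegree (k * g * l) (adTranslation H ω.conj k * (amplR Γ X * amplR Γ (α a)) *
        adTranslation H ω.conj l) := by
    rw [← amplR_mul, ha]
    exact ((hasDegree_adTranslation _ k).mul (hasDegree_amplR g _)).mul (hasDegree_adTranslation _ l)
  -- Translation by `m⁻¹` offsets the degree `m` of `c`; the same unitary in front of `b` then
  -- cancels in the product. The last factor `adTranslation H ω.conj 1` is the identity.
  have hc' := hdeg hc m⁻¹ 1
  have hb' := hdeg hb m⁻¹ k
  have hprod : 1 * amplR Γ (α (Star.star c * b)) * adTranslation H ω.conj k =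
      Star.star (adTranslation H ω.conj m⁻¹ * (amplR Γ X * amplR Γ (α c)) *
        adTranslation H ω.conj 1) *
      (adTranslation H ω.conj m⁻¹ * (amplR Γ X * amplR Γ (α b)) * adTranslation H ω.conj k) := by
    have h1 : ∀ S, Star.star (adTranslation H ω.conj m⁻¹) * (adTranslation H ω.conj m⁻¹ * S) =
        S := fun S => by rw [← mul_assoc, star_adTranslation_mul_self, _root_.one_mul]
    have h2 : ∀ S, Star.star (amplR Γ X) * (amplR Γ X * S) = S := fun S => by
      rw [← mul_assoc, h.amplR_star_mul_self, _root_.one_mul]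
    rw [adTranslation_one, mul_one, _root_.one_mul, map_mul, map_star, amplR_mul, ← star_amplR]
    simp only [star_mul, mul_assoc, h1, h2]
  rw [ContinuousLinearMap.comp_apply, sandwich_apply, hprod, (hc'.star.mul hb').diagExpectation_eq]
  -- The product has the degree of its second factor, so when the expectation does not vanish both
  -- factors have degree `1`.
  split_ifs with hg
  · have hk : m⁻¹ * n * k = 1 := by simpa using hg.symm
    rw [hk] at hb'
    rw [mul_one, inv_mul_cancel] at hc'
    refine subset_closedSpan ⟨_, h.star_mem_cocycleBimodule_of_hasDegree _ _ _ hc', _,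
      h.star_mem_cocycleBimodule_of_hasDegree _ _ _ hb', ?_⟩
    rw [star_star]
  · exact zero_mem _

theorem mem_closedSpan_star_mul (h : IsGradedTwist π α β X)
    {T : L2 (Γ × Γ) H →L[ℂ] L2 (Γ × Γ) H} (hT : T ∈ deformation β ω) :
    T ∈ closedSpan {z | ∃ x ∈ cocycleBimodule α ω X, ∃ y ∈ cocycleBimodule α ω X,
      z = Star.star x * y} := by
  refine closedSpan_le (isClosed_closedSpan _) ?_ (h.star.mem_closedSpan_mul_star hT)
  rintro _ ⟨x, hx, y, hy, rfl⟩
  exact subset_closedSpan ⟨_, h.star_mem_cocycleBimodule hx, _, h.star_mem_cocycleBimodule hy,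
    by rw [star_star]⟩

/-- The imprimitivity bimodule of a graded twist. -/
noncomputable def imprimitivityBimodule (h : IsGradedTwist π α β X) (ω : TwoCocycle Γ) :
    ImprimitivityBimodule (deformation α ω) (deformation β ω) (cocycleBimodule α ω X) where
  complete := h.isClosed_cocycleBimodule.completeSpace_coe
  lact := LinearMap.mk₂ ℂ (fun b x => ⟨b * x, h.mul_mem_cocycleBimodule b.2 x.2⟩)
    (fun _ _ _ => Subtype.ext (add_mul _ _ _)) (fun _ _ _ => Subtype.ext (smul_mul_assoc _ _ _))
    (fun _ _ _ => Subtype.ext (mul_add _ _ _)) (fun _ _ _ => Subtype.ext (mul_smul_comm _ _ _))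
  ract := LinearMap.mk₂ ℂ (fun c x => ⟨x * c, h.mem_mul_cocycleBimodule c.2 x.2⟩)
    (fun _ _ _ => Subtype.ext (mul_add _ _ _)) (fun _ _ _ => Subtype.ext (mul_smul_comm _ _ _))
    (fun _ _ _ => Subtype.ext (add_mul _ _ _)) (fun _ _ _ => Subtype.ext (smul_mul_assoc _ _ _))
  lact_mul _ _ _ := Subtype.ext (mul_assoc _ _ _)
  ract_mul _ _ _ := Subtype.ext (mul_assoc _ _ _).symm
  lact_ract _ _ _ := Subtype.ext (mul_assoc _ _ _).symm
  linner x y := ⟨x * Star.star (y : L2 (Γ × Γ) H →L[ℂ] L2 (Γ × Γ) H),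
    h.mul_star_mem_deformation x.2 y.2⟩
  rinner x y := ⟨Star.star (x : L2 (Γ × Γ) H →L[ℂ] L2 (Γ × Γ) H) * y,
    h.star_mul_mem_deformation x.2 y.2⟩
  linner_add _ _ _ := Subtype.ext (add_mul _ _ _)
  linner_smul _ _ _ := Subtype.ext (smul_mul_assoc _ _ _)
  linner_lact _ _ _ := Subtype.ext (mul_assoc _ _ _)
  star_linner _ _ := Subtype.ext (star_mul_star _ _)
  linner_self_nonneg x := by
    have hx := h.mul_star_mem_deformation x.2 x.2
    obtain ⟨b, hb, hxb⟩ := exists_eq_star_mul_self (deformation α ω) (isClosed_deformation α ω)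
      (x := Star.star (x : L2 (Γ × Γ) H →L[ℂ] L2 (Γ × Γ) H)) (by rwa [star_star])
    rw [star_star] at hxb
    exact ⟨⟨b, hb⟩, Subtype.ext hxb⟩
  norm_linner_self x := by
    rw [sq]
    exact CStarRing.norm_self_mul_star (E := L2 (Γ × Γ) H →L[ℂ] L2 (Γ × Γ) H) (x := x)
  linner_full := by
    refine dense_span_of_mem_closedSpan (fun b hb => h.mem_closedSpan_mul_star hb) ?_
    rintro _ ⟨x, hx, y, hy, rfl⟩
    exact ⟨_, ⟨⟨x, hx⟩, ⟨y, hy⟩, rfl⟩, rfl⟩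
  rinner_add _ _ _ := Subtype.ext (mul_add _ _ _)
  rinner_smul _ _ _ := Subtype.ext (mul_smul_comm _ _ _)
  rinner_ract _ _ _ := Subtype.ext (mul_assoc _ _ _).symm
  star_rinner _ _ := Subtype.ext (star_star_mul _ _)
  rinner_self_nonneg x := by
    obtain ⟨b, hb, hxb⟩ := exists_eq_star_mul_self (deformation β ω) (isClosed_deformation β ω)
      (h.star_mul_mem_deformation x.2 x.2)
    exact ⟨⟨b, hb⟩, Subtype.ext hxb⟩
  norm_rinner_self x := by
    rw [sq]
    exact CStarRing.norm_star_mul_self (E := L2 (Γ × Γ) H →L[ℂ] L2 (Γ × Γ) H) (x := x)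
  rinner_full := by
    refine dense_span_of_mem_closedSpan (fun b hb => h.mem_closedSpan_star_mul hb) ?_
    rintro _ ⟨x, hx, y, hy, rfl⟩
    exact ⟨_, ⟨⟨x, hx⟩, ⟨y, hy⟩, rfl⟩, rfl⟩
  rinner_lact _ _ _ := Subtype.ext (star_mul_mul _ _ _)
  linner_ract _ _ _ := Subtype.ext (mul_mul_star _ _ _)
  lact_linner _ _ _ := Subtype.ext (mul_assoc _ _ _)

end IsGradedTwist

end Bimodule

end Coact

theorem mainTheorem6 {Γ : Type*} [Group Γ]
    {A : Type*} [NonUnitalCStarAlgebra A]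
    {H : Type*} [NormedAddCommGroup H] [InnerProductSpace ℂ H] [CompleteSpace H]
    (π : A →⋆ₙₐ[ℂ] (H →L[ℂ] H)) (hπ : Coact.IsFaithfulNondegenerate π)
    (α β : A →⋆ₙₐ[ℂ] (Coact.L2 Γ H →L[ℂ] Coact.L2 Γ H))
    (hα : Coact.IsCoaction π α) (hβ : Coact.IsCoaction π β)
    (hαβ : Coact.ExteriorEquivalent π α β) (ω : Coact.TwoCocycle Γ) :
    Coact.StronglyMoritaEquivalent (Coact.deformation α ω) (Coact.deformation β ω) ∧
    ∀ X, Coact.IsExteriorEquivalence π α β X →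
      ∃ E : Coact.ImprimitivityBimodule (Coact.deformation α ω) (Coact.deformation β ω)
          (Coact.cocycleBimodule α ω X),
        (∀ b x, (E.lact b x : Coact.L2 (Γ × Γ) H →L[ℂ] Coact.L2 (Γ × Γ) H) = b * x) ∧
        (∀ c x, (E.ract c x : Coact.L2 (Γ × Γ) H →L[ℂ] Coact.L2 (Γ × Γ) H) = x * c) ∧
        (∀ x y, (E.linner x y : Coact.L2 (Γ × Γ) H →L[ℂ] Coact.L2 (Γ × Γ) H) =
          x * star (y : Coact.L2 (Γ × Γ) H →L[ℂ] Coact.L2 (Γ × Γ) H)) ∧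
        (∀ x y, (E.rinner x y : Coact.L2 (Γ × Γ) H →L[ℂ] Coact.L2 (Γ × Γ) H) =
          star (x : Coact.L2 (Γ × Γ) H →L[ℂ] Coact.L2 (Γ × Γ) H) * y) := by
  refine ⟨?_, fun X hX => ?_⟩
  · obtain ⟨X, hX⟩ := hαβ
    exact ⟨Coact.cocycleBimodule α ω X, inferInstance, inferInstance,
      ⟨(hX.isGradedTwist hπ hα hβ).imprimitivityBimodule ω⟩⟩
  · exact ⟨(hX.isGradedTwist hπ hα hβ).imprimitivityBimodule ω, fun _ _ => rfl, fun _ _ => rfl,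
      fun _ _ => rfl, fun _ _ => rfl⟩
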